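/- **Setting.** Let $A\in\mathbb R^{d_h\times d_y}$ have full row rank, $B\in\mathbb R^{d_h\times d_x}$, $b\in\mathbb R^{d_h}$, and put $h(x,y)=Bx+Ay-b$, $\mathcal Y(x)=\{y\in\mathbb R^{d_y}: h(x,y)\le 0\}$. Let $f,g:\mathbb R^{d_x}\times\mathbb R^{d_y}\to\mathbb R$ be continuously differentiable such that $f$ is $l_{f,0}$-Lipschitz on $\{(x,y): y\in\mathcal Y(x)\}$, $\nabla f$ and $\nabla g$ are $l_{f,1}$- and $l_{g,1}$-Lipschitz on $\mathbb R^{d_x}\times\mathbb R^{d_y}$, and $y\mapsto g(x,y)$ is $\mu_g$-strongly convex on $\mathbb R^{d_y}$ for every $x$, where $\mu_g>0$. Assume that $\Phi(x)=f(x,y^*(x))$ is bounded below, where $y^*(x)=\operatorname{argmin}_{y\in\mathcal Y(x)}g(x,y)$. For $\delta>0$ with $2l_{f,1}\delta\le\mu_g$ put $g_\delta=\delta f+g$ and $$\Phi_\delta(x)=\min_{y\in\mathcal Y(x)}\max_{z\in\mathcal Y(x)}\Big\{f(x,y)+\tfrac1\delta\big[g(x,y)-g(x,z)\big]\Big\},$$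 $$y^*_\delta(x)=\operatorname*{argmin}_{y\in\mathcal Y(x)}g_\delta(x,y),\qquad z^*(x)=y^*(x),$$ $$u^*_\delta(x)=\operatorname*{argmax}_{u\ge0}\min_{y\in\mathbb R^{d_y}}\{g_\delta(x,y)+u^\top h(x,y)\},\qquad v^*(x)=\operatorname*{argmax}_{v\ge0}\min_{z\in\mathbb R^{d_y}}\{g(x,z)+v^\top h(x,z)\}.$$ **Algorithm (SFLCB).** Let $\mathcal P_y=\{(y,\alpha)\in\mathbb R^{d_y}\times\mathbb R^{d_h}:\alpha\le0\}$ with Euclidean projection $\Pi_{\mathcal P_y}$ and, for $y'=(y,\alpha)$, $z'=(z,\beta)$, let $$\begin{aligned}K(x,y',z',u,v)={}&\delta f(x,y)+g(x,y)-g(x,z)+u^\top(h(x,y)-\alpha)-v^\top(h(x,z)-\beta)\\&+\tfrac{\rho_1}2\|h(x,y)-\alpha\|^2-\tfrac{\rho_2}2\|h(x,z)-\beta\|^2.\end{aligned}$$ From $x_0\in\mathbb R^{d_x}$, $y'_0=(y_0,\alpha_0)\in\mathcal P_y$, $z'_0=(z_0,\beta_0)\in\mathcal P_y$ and $u_0,v_0\in\mathbb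 R^{d_h}$, iterate $$\begin{aligned} u_{t+1}&=u_t+\eta_u(h(x_t,y_t)-\alpha_t),\qquad v_{t+1}=v_t+\eta_v(h(x_t,z_t)-\beta_t),\\ x_{t+1}&=x_t-\eta_x\nabla_xK(x_t,y'_t,z'_t,u_{t+1},v_{t+1}),\\ y'_{t+1}&=\Pi_{\mathcal P_y}\big(y'_t-\eta_y\nabla_{y'}K(x_t,y'_t,z'_t,u_{t+1},v_{t+1})\big),\\ z'_{t+1}&=\Pi_{\mathcal P_y}\big(z'_t+\eta_z\nabla_{z'}K(x_t,y'_t,z'_t,u_{t+1},v_{t+1})\big). \end{aligned}$$ **Theorem.** For all $\rho_1,\rho_2>0$ there are step sizes $\eta_x,\eta_y,\eta_z,\eta_u,\eta_v>0$, depending only on $A,B,\rho_1,\rho_2,\mu_g,l_{f,0},l_{f,1},l_{g,1}$ (in particular not on $\epsilon$ and $\delta$), such that for every problem as above and all constants $0<c_1\le c_2$ and $R>0$ the following holds. 1. There is $C>0$ such that for all $\epsilon\in(0,1]$ and all $\delta\in[c_1\epsilon,c_2\epsilon]$ with $2l_{f,1}\delta\le\mu_g$, and all initial points with $y_0',z_0'\in\mathcal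 P_y$ and $\|x_0\|,\|y'_0\|,\|z'_0\|,\|u_0\|,\|v_0\|\le R$: for every integer $T\ge C\epsilon^{-4}$ some iterate $x_t$ with $0\le t<T$ is an $\epsilon$-stationary point of $\Phi_\delta$; that is, $\Phi_\delta$ is differentiable on $\mathbb R^{d_x}$ and $\|\nabla\Phi_\delta(x_t)\|\le\epsilon$. 2. For every $\kappa>0$ there is $C>0$ such that for all $\epsilon,\delta$ as in 1 and all initial points with $y'_0,z'_0\in\mathcal P_y$, $\|x_0\|\le R$ and $$\|y_0-y^*_\delta(x_0)\|,\ \|u_0-u^*_\delta(x_0)\|,\ \|z_0-z^*(x_0)\|,\ \|v_0-v^*(x_0)\|,\ \|\alpha_0-h(x_0,y_0)\|,\ \|\beta_0-h(x_0,z_0)\|\ \le\ \kappa\delta,$$ for every integer $T\ge C\epsilon^{-3}$ some iterate $x_t$ with $0\le t<T$ is an $\epsilon$-stationary point of $\Phi_\delta$. -/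

import Mathlib

open scoped NNReal

noncomputable section

namespace SFLCB

/-- The Euclidean space `ℝⁿ` with the `ℓ²` norm. -/
abbrev Vec (n : ℕ) : Type := EuclideanSpace ℝ (Fin n)

/-- The Euclidean product `ℝᵐ × ℝⁿ` with the `ℓ²` norm of the concatenated vector. -/
abbrev Pair (m n : ℕ) : Type := WithLp 2 (Vec m × Vec n)

/-- The concatenation of two vectors. -/
abbrev pair {m n : ℕ} (a : Vec m) (b : Vec n) : Pair m n := WithLp.toLp 2 (a, b)

/-- A minimizer of `F` over `S` (an arbitrary point if there is none). -/
def argminOn {α : Type} [Nonempty α] (S : Set α) (F : α → ℝ) : α :=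
  Classical.epsilon fun a => a ∈ S ∧ IsMinOn F S a

/-- A maximizer of `F` over `S` (an arbitrary point if there is none). -/
def argmaxOn {α : Type} [Nonempty α] (S : Set α) (F : α → ℝ) : α :=
  Classical.epsilon fun a => a ∈ S ∧ IsMaxOn F S a

/-- The projection `Π_S(p) = argmin_{q ∈ S} ½‖p - q‖²`. -/
def proj {m n : ℕ} (S : Set (Pair m n)) (p : Pair m n) : Pair m n :=
  argminOn S fun q => (1 / 2 : ℝ) * ‖p - q‖ ^ 2

/-- `x` is an `ε`-stationary point of the differentiable function `F`. -/
def IsStationaryPoint {n : ℕ} (ε : ℝ) (F : Vec n → ℝ) (x : Vec n) : Prop :=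
  Differentiable ℝ F ∧ ‖gradient F x‖ ≤ ε

/-- The data of a bilevel problem with upper-level objective `f`, lower-level objective `g` and
lower-level constraint `B x + A y - b ≤ 0`. -/
structure Problem (dx dy dh : ℕ) where
  f : Pair dx dy → ℝ
  g : Pair dx dy → ℝ
  A : Matrix (Fin dh) (Fin dy) ℝ
  B : Matrix (Fin dh) (Fin dx) ℝ
  b : Vec dh

namespace Problem

variable {dx dy dh : ℕ} (P : Problem dx dy dh)

/-- The constraint function `h(x, y) = B x + A y - b`. -/
def h (x : Vec dx) (y : Vec dy) : Vec dh :=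
  P.B.toEuclideanLin x + P.A.toEuclideanLin y - P.b

/-- The lower-level feasible set `𝒴(x) = {y | h(x, y) ≤ 0}`. -/
def Y (x : Vec dx) : Set (Vec dy) := {y | ∀ i, P.h x y i ≤ 0}

/-- The penalized lower-level objective `g_δ = δ f + g`. -/
def gδ (δ : ℝ) (p : Pair dx dy) : ℝ := δ * P.f p + P.g p

/-- `y*(x) = z*(x) = argmin_{y ∈ 𝒴(x)} g(x, y)`. -/
def yStar (x : Vec dx) : Vec dy := argminOn (P.Y x) fun y => P.g (pair x y)

/-- `y*_δ(x) = argmin_{y ∈ 𝒴(x)} δ f(x, y) + g(x, y)`. -/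
def yStarδ (δ : ℝ) (x : Vec dx) : Vec dy := argminOn (P.Y x) fun y => P.gδ δ (pair x y)

/-- The optimal multiplier `u*_δ(x) = argmax_{u ≥ 0} min_y g_δ(x, y) + uᵀ h(x, y)`. -/
def uStarδ (δ : ℝ) (x : Vec dx) : Vec dh :=
  argmaxOn {u | ∀ i, 0 ≤ u i} fun u => ⨅ y : Vec dy, (P.gδ δ (pair x y) + inner ℝ u (P.h x y))

/-- The optimal multiplier `v*(x) = argmax_{v ≥ 0} min_z g(x, z) + vᵀ h(x, z)`. -/
def vStar (x : Vec dx) : Vec dh :=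
  argmaxOn {v | ∀ i, 0 ≤ v i} fun v => ⨅ z : Vec dy, (P.g (pair x z) + inner ℝ v (P.h x z))

/-- The hyper-objective `Φ(x) = f(x, y*(x))`. -/
def Φ (x : Vec dx) : ℝ := P.f (pair x (P.yStar x))

/-- The penalized hyper-objective
`Φ_δ(x) = min_{y ∈ 𝒴(x)} max_{z ∈ 𝒴(x)} f(x, y) + (g(x, y) - g(x, z)) / δ`. -/
def Φδ (δ : ℝ) (x : Vec dx) : ℝ :=
  ⨅ y : P.Y x, ⨆ z : P.Y x,
    (P.f (pair x y) + (1 / δ) * (P.g (pair x y) - P.g (pair x z)))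

/-- `φ_δ(x, y, z) = δ f(x, y) + g(x, y) - g(x, z)`. -/
def φδ (δ : ℝ) (x : Vec dx) (y z : Vec dy) : ℝ :=
  δ * P.f (pair x y) + P.g (pair x y) - P.g (pair x z)

/-- The standing assumptions on the problem. -/
structure Assumptions (lf₀ lf₁ lg₁ : ℝ≥0) (μg : ℝ) : Prop where
  f_contDiff : ContDiff ℝ 1 P.f
  g_contDiff : ContDiff ℝ 1 P.g
  Φ_bddBelow : BddBelow (Set.range P.Φ)
  f_lipschitz : LipschitzOnWith lf₀ P.f {p | p.snd ∈ P.Y p.fst}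
  grad_f_lipschitz : LipschitzWith lf₁ (gradient P.f)
  grad_g_lipschitz : LipschitzWith lg₁ (gradient P.g)
  g_strongConvex : ∀ x : Vec dx, StrongConvexOn Set.univ μg fun y => P.g (pair x y)

/-- The augmented Lagrangian
`K(x, y', z', u, v) = φ_δ(x, y, z) + uᵀ(h(x, y) - α) - vᵀ(h(x, z) - β)
  + (ρ₁/2) ‖h(x, y) - α‖² - (ρ₂/2) ‖h(x, z) - β‖²`, where `y' = (y, α)` and `z' = (z, β)`. -/
def K (δ ρ₁ ρ₂ : ℝ) (x : Vec dx) (y' z' : Pair dy dh) (u v : Vec dh) : ℝ :=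
  P.φδ δ x y'.fst z'.fst
    + inner ℝ u (P.h x y'.fst - y'.snd) - inner ℝ v (P.h x z'.fst - z'.snd)
    + ρ₁ / 2 * ‖P.h x y'.fst - y'.snd‖ ^ 2 - ρ₂ / 2 * ‖P.h x z'.fst - z'.snd‖ ^ 2

end Problem

/-- The set `𝒫_y = {(y, α) | α ≤ 0}`. -/
def Py (dy dh : ℕ) : Set (Pair dy dh) := {p | ∀ i, p.snd i ≤ 0}

/-- The variables `(x, y', z', u, v)` of the algorithm, with `y' = (y, α)` and `z' = (z, β)`. -/
structure State (dx dy dh : ℕ) where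
  x : Vec dx
  y' : Pair dy dh
  z' : Pair dy dh
  u : Vec dh
  v : Vec dh

/-- The step sizes of the algorithm. -/
structure StepSizes where
  ηx : ℝ
  ηy : ℝ
  ηz : ℝ
  ηu : ℝ
  ηv : ℝ

/-- All step sizes are positive. -/
def StepSizes.Pos (s : StepSizes) : Prop :=
  0 < s.ηx ∧ 0 < s.ηy ∧ 0 < s.ηz ∧ 0 < s.ηu ∧ 0 < s.ηv

namespace Problem

variable {dx dy dh : ℕ} (P : Problem dx dy dh)

/-- One iteration of the algorithm: the multipliers are updated first, and the new multipliers are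
used in the (projected) gradient steps for `x`, `y'` and `z'`. -/
def step (δ ρ₁ ρ₂ : ℝ) (s : StepSizes) (w : State dx dy dh) : State dx dy dh :=
  let u₁ : Vec dh := w.u + s.ηu • (P.h w.x w.y'.fst - w.y'.snd)
  let v₁ : Vec dh := w.v + s.ηv • (P.h w.x w.z'.fst - w.z'.snd)
  { x := w.x - s.ηx • gradient (fun x => P.K δ ρ₁ ρ₂ x w.y' w.z' u₁ v₁) w.x
    y' := proj (Py dy dh)
      (w.y' - s.ηy • gradient (fun y' => P.K δ ρ₁ ρ₂ w.x y' w.z' u₁ v₁) w.y')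
    z' := proj (Py dy dh)
      (w.z' + s.ηz • gradient (fun z' => P.K δ ρ₁ ρ₂ w.x w.y' z' u₁ v₁) w.z')
    u := u₁
    v := v₁ }

/-- The iterates `(x_t, y'_t, z'_t, u_t, v_t)` of the algorithm started at `w₀`. -/
def iterate (δ ρ₁ ρ₂ : ℝ) (s : StepSizes) (w₀ : State dx dy dh) (t : ℕ) : State dx dy dh :=
  (P.step δ ρ₁ ρ₂ s)^[t] w₀

/-- The initial variables are `κ δ`-close to the optimal ones at `x₀`; the slack variables are
compared with the constraint values `h(x₀, y₀)` and `h(x₀, z₀)`. -/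
def CloseToOptimal (δ κ : ℝ) (w₀ : State dx dy dh) : Prop :=
  ‖w₀.y'.fst - P.yStarδ δ w₀.x‖ ≤ κ * δ ∧ ‖w₀.u - P.uStarδ δ w₀.x‖ ≤ κ * δ ∧
  ‖w₀.z'.fst - P.yStar w₀.x‖ ≤ κ * δ ∧ ‖w₀.v - P.vStar w₀.x‖ ≤ κ * δ ∧
  ‖w₀.y'.snd - P.h w₀.x w₀.y'.fst‖ ≤ κ * δ ∧ ‖w₀.z'.snd - P.h w₀.x w₀.z'.fst‖ ≤ κ * δ

end Problem

/-- Admissible starting points: `y'_0, z'_0 ∈ 𝒫_y`. -/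
def State.Admissible {dx dy dh : ℕ} (w : State dx dy dh) : Prop :=
  w.y' ∈ Py dy dh ∧ w.z' ∈ Py dy dh

/-- All variables have norm at most `R`. -/
def State.BoundedBy {dx dy dh : ℕ} (w : State dx dy dh) (R : ℝ) : Prop :=
  ‖w.x‖ ≤ R ∧ ‖w.y'‖ ≤ R ∧ ‖w.z'‖ ≤ R ∧ ‖w.u‖ ≤ R ∧ ‖w.v‖ ≤ R

end SFLCB

end

/-!
The `x`-update is an inexact gradient step for the scaled hyper-objective `δ Φ_δ`, and everything
rests on the fact that the two lower-level problems are tracked at a linear rate that does not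
depend on `δ`.

Write `q` for either lower-level objective: `g_δ`, or `g` itself. Since `2 l_{f,1} δ ≤ μ_g`, both
are `μ_g / 2`-strongly convex in the lower-level variable and have
`(l_{g,1} + μ_g / 2)`-Lipschitz gradients (`LowerObjective`), uniformly in `δ`. In the slack form
with `p = (y, α)`, `α ≤ 0`, the augmented Lagrangian is strongly convex in `p`, because the quadratic
penalty supplies the curvature in `α`. At a minimizer over `α ≤ 0` the `y`-component of the gradient
vanishes; as `Aᵀ` is bounded below, the multiplier is then a Lipschitz function of the minimizer, so
the dual function is strongly concave on the whole space (`exists_saddleFamily`). Two applications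
of the Banach fixed-point theorem give the saddle point, its Lipschitz dependence on `x`, and an
energy `E` that is comparable to the distance to the saddle point and contracts under one multiplier
step followed by one projected gradient step, provided the multiplier step is short
(`SaddleFamily.exists_trackingEnergy`). The saddle point satisfies the KKT conditions, and these
show that the value function `min q(x, ·)` has gradient `∇ₓ q + Bᵀ u` at the saddle point, with a
quadratic error (`exists_blockEnergy`).

By `Problem.mul_Φδ_eq`, `F = δ Φ_δ` is the difference of the two value functions. Its gradient is
approximated by the step direction of `x` up to the sum `e` of the two energies, and moving `x`
increases `e` by at most a multiple of the length of the move. For a small step size `η` the potential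
`F + e²` therefore decreases by `(η / 2) ‖∇F‖²` in each iteration
(`card_mul_sq_le_of_inexact_descent`). An iterate that is not `ε`-stationary has `‖∇F‖ > δ ε`, so
the number of initial iterates that are not stationary is at most of the order of
`(δ (Φ_δ(x₀) - inf Φ_δ) + e₀²) / (δ ε)²`. The bounds `Φ - δ l_{f,0}² / μ_g ≤ Φ_δ ≤ Φ` make the first
term `O(δ)`. With `δ` of the order of `ε`, a bounded initial energy gives `ε⁻⁴`, and an initial
energy `e₀ = O(δ)` gives `ε⁻³`.
-/

noncomputable section

namespace SFLCB

/-! ### Two-timescale tracking of a strongly monotone saddle point -/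

section Tracking

/-- A short explicit step along a strongly monotone Lipschitz increment `w` contracts `v`. -/
lemma norm_sub_smul_le_of_strongly_monotone {E : Type*} [NormedAddCommGroup E]
    [InnerProductSpace ℝ E] {m L η : ℝ} {v w : E} (hm : 0 < m) (hmL : m ≤ L) (hη : 0 ≤ η)
    (hηL : η * L ^ 2 ≤ m) (hmono : m * ‖v‖ ^ 2 ≤ inner ℝ w v) (hlip : ‖w‖ ≤ L * ‖v‖) :
    ‖v - η • w‖ ≤ (1 - η * m / 2) * ‖v‖ := by
  have hL : 0 < L := hm.trans_le hmL
  have h1 : η * m ≤ 1 := by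
    have : η * m * L ^ 2 ≤ 1 * L ^ 2 := by nlinarith
    exact le_of_mul_le_mul_right this (by positivity)
  have h2 : ‖v - η • w‖ ^ 2 = ‖v‖ ^ 2 - 2 * η * inner ℝ w v + η ^ 2 * ‖w‖ ^ 2 := by
    rw [norm_sub_sq_real, inner_smul_right, real_inner_comm, norm_smul, mul_pow, Real.norm_eq_abs,
      sq_abs]
    ring
  have h3 : ‖w‖ ^ 2 ≤ L ^ 2 * ‖v‖ ^ 2 := by
    rw [← mul_pow]; exact pow_le_pow_left₀ (norm_nonneg _) hlip 2
  have h4 : η ^ 2 * ‖w‖ ^ 2 ≤ η * m * ‖v‖ ^ 2 := by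
    calc η ^ 2 * ‖w‖ ^ 2 ≤ η ^ 2 * (L ^ 2 * ‖v‖ ^ 2) := by gcongr
      _ = η * (η * L ^ 2) * ‖v‖ ^ 2 := by ring
      _ ≤ η * m * ‖v‖ ^ 2 := by gcongr
  refine le_of_sq_le_sq ?_ (mul_nonneg (by linarith) (norm_nonneg _))
  rw [h2, mul_pow]
  have h5 : 2 * η * (m * ‖v‖ ^ 2) ≤ 2 * η * inner ℝ w v := by gcongr
  nlinarith [sq_nonneg (η * m * ‖v‖)]

lemma exists_fixedPoint_of_norm_sub_le {E : Type*} [NormedAddCommGroup E] [CompleteSpace E]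
    {f : E → E} {κ : ℝ} (hκ0 : 0 ≤ κ) (hκ : κ < 1) (h : ∀ a b, ‖f a - f b‖ ≤ κ * ‖a - b‖) :
    ∃ p, f p = p := by
  have hc : ContractingWith ⟨κ, hκ0⟩ f := by
    refine ⟨by exact_mod_cast hκ, LipschitzWith.of_dist_le_mul fun a b => ?_⟩
    rw [dist_eq_norm, dist_eq_norm]
    exact h a b
  exact ⟨_, hc.fixedPoint_isFixedPt⟩

variable {X P U : Type*} [NormedAddCommGroup X]
  [NormedAddCommGroup P] [InnerProductSpace ℝ P]
  [NormedAddCommGroup U] [InnerProductSpace ℝ U]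

/-- A family, indexed by a slow variable `x`, of saddle problems with primal field `T x u`,
constraint residual `c x` (the derivative in the multiplier `u`) and projection `Pr`. The field is
strongly monotone in `p`; the `dual` hypothesis is the strong concavity of the dual function,
expressed through the solutions `p` of the projected primal equation, which is written with the
step `m / L ^ 2` that makes the projected step a contraction. -/
structure SaddleFamily (m L : ℝ) (T : X → U → P → P) (c : X → P → U) (Pr : P → P) : Prop where
  proj_lip : ∀ a b, ‖Pr a - Pr b‖ ≤ ‖a - b‖
  mono : ∀ x u p₁ p₂, m * ‖p₁ - p₂‖ ^ 2 ≤ inner ℝ (T x u p₁ - T x u p₂) (p₁ - p₂)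
  lip : ∀ x₁ x₂ u₁ u₂ p₁ p₂,
    ‖T x₁ u₁ p₁ - T x₂ u₂ p₂‖ ≤ L * (‖x₁ - x₂‖ + ‖u₁ - u₂‖ + ‖p₁ - p₂‖)
  lip_c : ∀ x₁ x₂ p₁ p₂, ‖c x₁ p₁ - c x₂ p₂‖ ≤ L * (‖x₁ - x₂‖ + ‖p₁ - p₂‖)
  dual : ∀ x u₁ u₂ p₁ p₂, Pr (p₁ - (m / L ^ 2) • T x u₁ p₁) = p₁ →
    Pr (p₂ - (m / L ^ 2) • T x u₂ p₂) = p₂ →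
    m * ‖u₁ - u₂‖ ^ 2 ≤ inner ℝ (c x p₂ - c x p₁) (u₁ - u₂)

/-- The saddle point `(pS x, uS x)` of a saddle family, together with an energy `E x p u` that
measures the distance of `(p, u)` to it and contracts along a multiplier step followed by a
projected primal step. -/
structure TrackingEnergy (η ηu γ C : ℝ) (T : X → U → P → P) (c : X → P → U) (Pr : P → P)
    (pS : X → P) (uS : X → U) (E : X → P → U → ℝ) : Prop where
  fixed : ∀ x, Pr (pS x - η • T x (uS x) (pS x)) = pS x
  feasible : ∀ x, c x (pS x) = 0
  lip_pS : ∀ x₁ x₂, ‖pS x₁ - pS x₂‖ ≤ C * ‖x₁ - x₂‖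
  lip_uS : ∀ x₁ x₂, ‖uS x₁ - uS x₂‖ ≤ C * ‖x₁ - x₂‖
  nonneg : ∀ x p u, 0 ≤ E x p u
  contract : ∀ x p u, E x (Pr (p - η • T x (u + ηu • c x p) p)) (u + ηu • c x p)
    ≤ (1 - γ) * E x p u
  drift : ∀ x₁ x₂ p u, E x₁ p u ≤ E x₂ p u + C * ‖x₁ - x₂‖
  le_dist : ∀ x p u, E x p u ≤ C * (‖p - pS x‖ + ‖u - uS x‖)
  le_residual : ∀ x p u, Pr p = p → E x p u ≤ C * (‖T x u p‖ + ‖c x p‖)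
  primal_le : ∀ x p u, ‖p - pS x‖ ≤ C * E x p u
  dual_le : ∀ x p u, ‖u + ηu • c x p - uS x‖ ≤ C * E x p u

namespace SaddleFamily

variable {m L : ℝ} {T : X → U → P → P} {c : X → P → U} {Pr : P → P}

lemma primal_contract (h : SaddleFamily m L T c Pr) (hm : 0 < m) (hmL : m ≤ L) (x : X) (u : U)
    (p₁ p₂ : P) :
    ‖Pr (p₁ - (m / L ^ 2) • T x u p₁) - Pr (p₂ - (m / L ^ 2) • T x u p₂)‖
      ≤ (1 - m / L ^ 2 * m / 2) * ‖p₁ - p₂‖ := by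
  have hL : 0 < L := hm.trans_le hmL
  refine (h.proj_lip _ _).trans ?_
  have e : p₁ - (m / L ^ 2) • T x u p₁ - (p₂ - (m / L ^ 2) • T x u p₂)
      = (p₁ - p₂) - (m / L ^ 2) • (T x u p₁ - T x u p₂) := by rw [smul_sub]; abel
  rw [e]
  refine norm_sub_smul_le_of_strongly_monotone hm hmL (by positivity) ?_ (h.mono x u p₁ p₂) ?_
  · rw [div_mul_cancel₀ _ (by positivity)]
  · simpa using h.lip x x u u p₁ p₂

lemma exists_primal [CompleteSpace P] (h : SaddleFamily m L T c Pr) (hm : 0 < m) (hmL : m ≤ L)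
    (x : X) (u : U) :
    ∃ p, Pr (p - (m / L ^ 2) • T x u p) = p := by
  have hL : 0 < L := hm.trans_le hmL
  have h1 : m / L ^ 2 * m ≤ 1 := by
    rw [div_mul_eq_mul_div, div_le_one (by positivity)]; nlinarith
  have h2 : 0 < m / L ^ 2 * m := by positivity
  exact exists_fixedPoint_of_norm_sub_le (by linarith) (by linarith)
    (h.primal_contract hm hmL x u)

lemma primal_residual (h : SaddleFamily m L T c Pr) (hm : 0 < m) (hmL : m ≤ L) {x : X} {u : U}
    {p q : P} (hq : Pr (q - (m / L ^ 2) • T x u q) = q) :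
    ‖p - q‖ ≤ 2 * L ^ 2 / m ^ 2 * ‖p - Pr (p - (m / L ^ 2) • T x u p)‖ := by
  have hL : 0 < L := hm.trans_le hmL
  have h1 := h.primal_contract hm hmL x u p q
  rw [hq] at h1
  have h2 := norm_sub_le_norm_sub_add_norm_sub p (Pr (p - (m / L ^ 2) • T x u p)) q
  have h3 : m ^ 2 / (2 * L ^ 2) * ‖p - q‖ ≤ ‖p - Pr (p - (m / L ^ 2) • T x u p)‖ := by
    have : m / L ^ 2 * m / 2 = m ^ 2 / (2 * L ^ 2) := by field_simp
    rw [this] at h1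
    linarith
  calc ‖p - q‖ = 2 * L ^ 2 / m ^ 2 * (m ^ 2 / (2 * L ^ 2) * ‖p - q‖) := by field_simp
    _ ≤ _ := by gcongr

lemma primal_lip (h : SaddleFamily m L T c Pr) (hm : 0 < m) (hmL : m ≤ L) {x₁ x₂ : X} {u₁ u₂ : U}
    {p₁ p₂ : P} (h₁ : Pr (p₁ - (m / L ^ 2) • T x₁ u₁ p₁) = p₁)
    (h₂ : Pr (p₂ - (m / L ^ 2) • T x₂ u₂ p₂) = p₂) :
    ‖p₁ - p₂‖ ≤ 2 * L / m * (‖x₁ - x₂‖ + ‖u₁ - u₂‖) := by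
  have hL : 0 < L := hm.trans_le hmL
  have h3 := h.primal_residual (p := p₁) hm hmL h₂
  have h4 : ‖p₁ - Pr (p₁ - (m / L ^ 2) • T x₂ u₂ p₁)‖
      ≤ m / L ^ 2 * (L * (‖x₁ - x₂‖ + ‖u₁ - u₂‖)) := by
    nth_rewrite 1 [← h₁]
    refine (h.proj_lip _ _).trans ?_
    rw [sub_sub_sub_cancel_left, ← smul_sub, norm_smul, Real.norm_of_nonneg (by positivity),
      norm_sub_rev]
    gcongr
    simpa using h.lip x₁ x₂ u₁ u₂ p₁ p₁
  calc _ ≤ _ := h3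
    _ ≤ 2 * L ^ 2 / m ^ 2 * (m / L ^ 2 * (L * (‖x₁ - x₂‖ + ‖u₁ - u₂‖))) := by gcongr
    _ = _ := by field_simp

/-- The saddle point is found by the Banach fixed-point theorem, once in the primal variable for
each multiplier, and once in the multiplier. The energy is the distance of the multiplier to its
optimal value plus a small multiple of the distance of `p` to the primal solution for the current
multiplier. -/
theorem exists_trackingEnergy [CompleteSpace P] [CompleteSpace U] (hm : 0 < m) (hmL : m ≤ L) :
    ∃ ηu γ C : ℝ, 0 < ηu ∧ 0 < γ ∧ γ ≤ 1 ∧ 0 < C ∧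
      ∀ (T : X → U → P → P) (c : X → P → U) (Pr : P → P), SaddleFamily m L T c Pr →
        ∃ pS uS E, TrackingEnergy (m / L ^ 2) ηu γ C T c Pr pS uS E := by
  have hL : 0 < L := hm.trans_le hmL
  obtain ⟨Lp, hLp⟩ : ∃ Lp, Lp = 2 * L / m := ⟨_, rfl⟩
  have hLp0 : 0 < Lp := by rw [hLp]; positivity
  obtain ⟨LD, hLD⟩ : ∃ LD, LD = L * (1 + Lp) := ⟨_, rfl⟩
  have hLD0 : 0 < LD := by rw [hLD]; positivity
  have hmLD : m ≤ LD := by rw [hLD]; nlinarith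
  -- The weight `k` is so small that the motion of the primal solution caused by the multiplier step
  -- costs at most half of the contraction of the multiplier.
  obtain ⟨k, hk⟩ : ∃ k, k = m / (4 * Lp * LD) := ⟨_, rfl⟩
  have hk0 : 0 < k := by rw [hk]; positivity
  have hkm : k * Lp * LD = m / 4 := by rw [hk]; field_simp
  obtain ⟨θ, hθ⟩ : ∃ θ, θ = m / L ^ 2 * m / 2 := ⟨_, rfl⟩
  have hθ0 : 0 < θ := by rw [hθ]; positivity
  have hθ1 : θ ≤ 1 / 2 := by
    rw [hθ]
    have h1 : m / L ^ 2 * m ≤ 1 := by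
      rw [div_mul_eq_mul_div, div_le_one (by positivity)]; nlinarith
    linarith
  -- The first bound makes the dual ascent map a contraction; the second lets the primal contraction
  -- `1 - θ` absorb what the multiplier step does to the primal error.
  obtain ⟨ηu, hηu⟩ : ∃ ηu, ηu = min (m / LD ^ 2) (k * θ / (2 * (L + k * Lp * L))) := ⟨_, rfl⟩
  have hηu0 : 0 < ηu := by rw [hηu]; exact lt_min (by positivity) (by positivity)
  have hηu1 : ηu * LD ^ 2 ≤ m := by
    rw [← le_div_iff₀ (by positivity), hηu]; exact min_le_left _ _
  have hηu2 : ηu * (L + k * Lp * L) ≤ k * θ / 2 := by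
    have : ηu ≤ k * θ / (2 * (L + k * Lp * L)) := by rw [hηu]; exact min_le_right _ _
    rw [le_div_iff₀ (by positivity)] at this
    linarith
  obtain ⟨γ, hγ⟩ : ∃ γ, γ = min (ηu * m / 4) (θ / 2) := ⟨_, rfl⟩
  have hγ0 : 0 < γ := by rw [hγ]; exact lt_min (by positivity) (by positivity)
  have hγ1 : γ ≤ ηu * m / 4 := by rw [hγ]; exact min_le_left _ _
  have hγ2 : γ ≤ θ / 2 := by rw [hγ]; exact min_le_right _ _
  have hηm : ηu * m ≤ 1 := by
    have : ηu * m * LD ^ 2 ≤ 1 * LD ^ 2 := by nlinarith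
    exact le_of_mul_le_mul_right this (by positivity)
  obtain ⟨C, hC1, hC2, hC3, hC4, hC5, hC6, hC7, hC8⟩ : ∃ C : ℝ,
      Lp * (1 + LD / m) ≤ C ∧ LD / m ≤ C ∧ LD / m + k * Lp ≤ C ∧ 1 + k + k * Lp ≤ C ∧
      (k + L / m) * (2 / m) ≤ C ∧ 1 / m ≤ C ∧ 1 / k + Lp ≤ C ∧ 1 + ηu * L / k ≤ C := by
    refine ⟨Lp * (1 + LD / m) + LD / m + k * Lp + (1 + k + k * Lp) + (k + L / m) * (2 / m) + 1 / m +
      (1 / k + Lp) + (1 + ηu * L / k), ?_⟩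
    have a1 : 0 < Lp * (1 + LD / m) := by positivity
    have a2 : 0 < LD / m := by positivity
    have a3 : 0 < k * Lp := by positivity
    have a5 : 0 < (k + L / m) * (2 / m) := by positivity
    have a6 : 0 < 1 / m := by positivity
    have a7 : 0 < 1 / k := by positivity
    have a8 : 0 < ηu * L / k := by positivity
    refine ⟨?_, ?_, ?_, ?_, ?_, ?_, ?_, ?_⟩ <;> linarith
  have hC0 : 0 < C := lt_of_lt_of_le (by positivity) hC6
  refine ⟨ηu, γ, C, hηu0, hγ0, by linarith, hC0, fun T c Pr h => ?_⟩
  choose pS' hpS using fun x u => h.exists_primal hm hmL x u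
  have hlip : ∀ x₁ x₂ u₁ u₂,
      ‖pS' x₁ u₁ - pS' x₂ u₂‖ ≤ Lp * (‖x₁ - x₂‖ + ‖u₁ - u₂‖) := fun x₁ x₂ u₁ u₂ => by
    rw [hLp]; exact h.primal_lip hm hmL (hpS x₁ u₁) (hpS x₂ u₂)
  have hD : ∀ x₁ x₂ u₁ u₂, ‖c x₁ (pS' x₁ u₁) - c x₂ (pS' x₂ u₂)‖
      ≤ LD * (‖x₁ - x₂‖ + ‖u₁ - u₂‖) := fun x₁ x₂ u₁ u₂ => by
    refine (h.lip_c _ _ _ _).trans ?_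
    rw [hLD, mul_assoc]
    gcongr
    have := hlip x₁ x₂ u₁ u₂
    have := norm_nonneg (u₁ - u₂)
    linarith
  have hdual : ∀ x u₁ u₂, ‖(u₁ + ηu • c x (pS' x u₁)) - (u₂ + ηu • c x (pS' x u₂))‖
      ≤ (1 - ηu * m / 2) * ‖u₁ - u₂‖ := fun x u₁ u₂ => by
    have e : (u₁ + ηu • c x (pS' x u₁)) - (u₂ + ηu • c x (pS' x u₂))
        = (u₁ - u₂) - ηu • (c x (pS' x u₂) - c x (pS' x u₁)) := by rw [smul_sub]; abel
    rw [e]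
    refine norm_sub_smul_le_of_strongly_monotone hm hmLD hηu0.le hηu1
      (h.dual x u₁ u₂ _ _ (hpS x u₁) (hpS x u₂)) ?_
    have := hD x x u₂ u₁
    rwa [sub_self, norm_zero, zero_add, norm_sub_rev u₂] at this
  have hex : ∀ x, ∃ u, u + ηu • c x (pS' x u) = u := fun x =>
    exists_fixedPoint_of_norm_sub_le (by linarith) (by nlinarith) (hdual x)
  choose uS huS using hex
  have hfeas : ∀ x, c x (pS' x (uS x)) = 0 := fun x => by
    have := huS x
    rw [add_eq_left] at this
    exact (smul_eq_zero.mp this).resolve_left hηu0.ne'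
  have hu_le : ∀ x u, ‖u - uS x‖ ≤ 1 / m * ‖c x (pS' x u)‖ := fun x u => by
    have h1 := h.dual x u (uS x) _ _ (hpS x u) (hpS x (uS x))
    rw [hfeas, zero_sub] at h1
    have h2 := h1.trans (real_inner_le_norm _ _)
    rw [norm_neg] at h2
    rcases (norm_nonneg (u - uS x)).eq_or_lt with h0 | h0
    · rw [← h0]; positivity
    · rw [one_div, ← div_eq_inv_mul, le_div_iff₀ hm]
      refine le_of_mul_le_mul_right ?_ h0
      linarith
  have huLip : ∀ x₁ x₂, ‖uS x₁ - uS x₂‖ ≤ LD / m * ‖x₁ - x₂‖ := fun x₁ x₂ => by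
    have h1 := hu_le x₂ (uS x₁)
    have h2 := hD x₂ x₁ (uS x₁) (uS x₁)
    rw [hfeas, sub_zero, sub_self, norm_zero, add_zero, norm_sub_rev] at h2
    calc _ ≤ _ := h1
      _ ≤ 1 / m * (LD * ‖x₁ - x₂‖) := by gcongr
      _ = _ := by ring
  have hsplit : ∀ x p u, ‖p - pS' x (uS x)‖ ≤ ‖p - pS' x u‖ + Lp * ‖u - uS x‖ := fun x p u => by
    refine (norm_sub_le_norm_sub_add_norm_sub p (pS' x u) _).trans ?_
    have := hlip x x u (uS x)
    rw [sub_self, norm_zero, zero_add] at this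
    linarith
  have hsplit' : ∀ x p u, ‖p - pS' x u‖ ≤ ‖p - pS' x (uS x)‖ + Lp * ‖u - uS x‖ := fun x p u => by
    refine (norm_sub_le_norm_sub_add_norm_sub p (pS' x (uS x)) _).trans ?_
    have := hlip x x (uS x) u
    rw [sub_self, norm_zero, zero_add, norm_sub_rev (uS x)] at this
    linarith
  have hstep : ∀ x p u, ‖u + ηu • c x p - uS x‖
      ≤ (1 - ηu * m / 2) * ‖u - uS x‖ + ηu * L * ‖p - pS' x u‖ := fun x p u => by
    have h1 := hdual x u (uS x)
    rw [huS] at h1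
    have e : u + ηu • c x p - uS x
        = (u + ηu • c x (pS' x u) - uS x) + ηu • (c x p - c x (pS' x u)) := by
      rw [smul_sub]; abel
    have h2 := h.lip_c x x p (pS' x u)
    rw [sub_self, norm_zero, zero_add] at h2
    rw [e]
    refine (norm_add_le _ _).trans (add_le_add h1 ?_)
    rw [norm_smul, Real.norm_of_nonneg hηu0.le, mul_assoc]
    gcongr
  refine ⟨fun x => pS' x (uS x), uS, fun x p u => ‖u - uS x‖ + k * ‖p - pS' x u‖, ?_⟩
  constructor
  · exact fun x => hpS x (uS x)
  · exact hfeas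
  · intro x₁ x₂
    have h1 := hlip x₁ x₂ (uS x₁) (uS x₂)
    have h2 := huLip x₁ x₂
    calc _ ≤ _ := h1
      _ ≤ Lp * (‖x₁ - x₂‖ + LD / m * ‖x₁ - x₂‖) := by gcongr
      _ = Lp * (1 + LD / m) * ‖x₁ - x₂‖ := by ring
      _ ≤ _ := by gcongr
  · intro x₁ x₂
    exact (huLip x₁ x₂).trans (by gcongr)
  · intro x p u; positivity
  · intro x p u
    set u' := u + ηu • c x p with hu'
    have h1 := hstep x p u
    rw [← hu'] at h1
    have h2 := h.primal_contract hm hmL x u' p (pS' x u')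
    rw [hpS, ← hθ] at h2
    have h3 := norm_sub_le_norm_sub_add_norm_sub p (pS' x u) (pS' x u')
    have h4 := hlip x x u u'
    have h5 : ‖u - u'‖ ≤ ηu * (L * ‖p - pS' x u‖ + LD * ‖u - uS x‖) := by
      have e : u - u' = -(ηu • ((c x p - c x (pS' x u)) +
          (c x (pS' x u) - c x (pS' x (uS x))))) := by
        rw [hfeas, sub_zero, sub_add_cancel, hu']; abel
      rw [e, norm_neg, norm_smul, Real.norm_of_nonneg hηu0.le]
      have a1 := h.lip_c x x p (pS' x u)
      have a2 := hD x x u (uS x)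
      rw [sub_self, norm_zero, zero_add] at a1 a2
      gcongr
      exact (norm_add_le _ _).trans (add_le_add a1 a2)
    rw [sub_self, norm_zero, zero_add] at h4
    set a := ‖p - pS' x u‖
    set r := ‖u - uS x‖
    have ha : 0 ≤ a := norm_nonneg _
    have hr : 0 ≤ r := norm_nonneg _
    have h6 : ‖p - pS' x u'‖ ≤ a + Lp * (ηu * (L * a + LD * r)) := by
      have : Lp * ‖u - u'‖ ≤ Lp * (ηu * (L * a + LD * r)) := by gcongr
      linarith
    have h7 : k * ‖Pr (p - (m / L ^ 2) • T x u' p) - pS' x u'‖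
        ≤ k * ((1 - θ) * a + Lp * (ηu * (L * a + LD * r))) := by
      gcongr
      have b1 : (1 - θ) * ‖p - pS' x u'‖ ≤ (1 - θ) * (a + Lp * (ηu * (L * a + LD * r))) := by
        gcongr; linarith
      have b2 : 0 ≤ θ * (Lp * (ηu * (L * a + LD * r))) := by positivity
      linarith
    have h8 : ηu * (L + k * Lp * L) * a ≤ k * θ / 2 * a := by gcongr
    have h9 : ηu * (k * Lp * LD) * r = ηu * (m / 4) * r := by rw [hkm]
    have h10 : γ * r ≤ ηu * m / 4 * r := by gcongr
    have h11 : k * (γ * a) ≤ k * (θ / 2 * a) := by gcongr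
    linarith
  · intro x₁ x₂ p u
    have h1 := norm_sub_le_norm_sub_add_norm_sub u (uS x₂) (uS x₁)
    have h2 := huLip x₂ x₁
    have h3 := norm_sub_le_norm_sub_add_norm_sub p (pS' x₂ u) (pS' x₁ u)
    have h4 := hlip x₂ x₁ u u
    rw [sub_self u, norm_zero, add_zero] at h4
    rw [norm_sub_rev x₂] at h2 h4
    have h5 : k * ‖p - pS' x₁ u‖ ≤ k * (‖p - pS' x₂ u‖ + Lp * ‖x₁ - x₂‖) := by
      gcongr; linarith
    have h6 : (LD / m + k * Lp) * ‖x₁ - x₂‖ ≤ C * ‖x₁ - x₂‖ := by gcongr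
    linarith
  · intro x p u
    have h1 : k * ‖p - pS' x u‖ ≤ k * (‖p - pS' x (uS x)‖ + Lp * ‖u - uS x‖) := by
      gcongr; exact hsplit' x p u
    have h2 : (1 + k + k * Lp) * (‖p - pS' x (uS x)‖ + ‖u - uS x‖)
        ≤ C * (‖p - pS' x (uS x)‖ + ‖u - uS x‖) := by gcongr
    have h3 : 0 ≤ (1 + k * Lp) * ‖p - pS' x (uS x)‖ := by positivity
    have h4 : 0 ≤ k * ‖u - uS x‖ := by positivity
    linarith
  · intro x p u hp
    have h1 : ‖p - pS' x u‖ ≤ 2 / m * ‖T x u p‖ := by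
      have a1 := h.primal_residual (p := p) hm hmL (hpS x u)
      have a2 : ‖p - Pr (p - (m / L ^ 2) • T x u p)‖ ≤ m / L ^ 2 * ‖T x u p‖ := by
        nth_rewrite 1 [← hp]
        refine (h.proj_lip _ _).trans ?_
        rw [sub_sub_cancel, norm_smul, Real.norm_of_nonneg (by positivity)]
      calc _ ≤ _ := a1
        _ ≤ 2 * L ^ 2 / m ^ 2 * (m / L ^ 2 * ‖T x u p‖) := by gcongr
        _ = 2 / m * ‖T x u p‖ := by field_simp
    have h2 := hu_le x u
    have h3 := h.lip_c x x (pS' x u) p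
    rw [sub_self, norm_zero, zero_add, norm_sub_rev _ p] at h3
    have h4 : ‖c x (pS' x u)‖ ≤ ‖c x p‖ + L * ‖p - pS' x u‖ := by
      have := norm_le_norm_add_norm_sub' (c x (pS' x u)) (c x p)
      linarith
    have h5 : 1 / m * ‖c x (pS' x u)‖ ≤ 1 / m * (‖c x p‖ + L * ‖p - pS' x u‖) := by gcongr
    have h6 : (k + L / m) * ‖p - pS' x u‖ ≤ (k + L / m) * (2 / m * ‖T x u p‖) := by gcongr
    have h7 : (k + L / m) * (2 / m) * ‖T x u p‖ ≤ C * ‖T x u p‖ := by gcongr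
    have h8 : 1 / m * ‖c x p‖ ≤ C * ‖c x p‖ := by gcongr
    have e : 1 / m * (L * ‖p - pS' x u‖) = L / m * ‖p - pS' x u‖ := by ring
    linarith
  · intro x p u
    have h1 := hsplit x p u
    have h2 : (1 / k + Lp) * (‖u - uS x‖ + k * ‖p - pS' x u‖)
        ≤ C * (‖u - uS x‖ + k * ‖p - pS' x u‖) := by gcongr
    have h3 : 1 / k * (k * ‖p - pS' x u‖) = ‖p - pS' x u‖ := by field_simp
    have h4 : 0 ≤ 1 / k * ‖u - uS x‖ := by positivity
    have h5 : 0 ≤ Lp * (k * ‖p - pS' x u‖) := by positivity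
    linarith
  · intro x p u
    have h1 := hstep x p u
    have h2 : (1 + ηu * L / k) * (‖u - uS x‖ + k * ‖p - pS' x u‖)
        ≤ C * (‖u - uS x‖ + k * ‖p - pS' x u‖) := by gcongr
    have h3 : ηu * L / k * (k * ‖p - pS' x u‖) = ηu * L * ‖p - pS' x u‖ := by field_simp
    have h4 : 0 ≤ ηu * L / k * ‖u - uS x‖ := by positivity
    have h5 : 0 ≤ k * ‖p - pS' x u‖ := by positivity
    have h6 : 0 ≤ ηu * m / 2 * ‖u - uS x‖ := by positivity
    linarith

end SaddleFamily

end Tracking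

/-! ### Projections, strong convexity and Lipschitz gradients -/

lemma proj_spec {m n : ℕ} {S : Set (Pair m n)} (hne : S.Nonempty) (hcl : IsClosed S)
    (hconv : Convex ℝ S) (p : Pair m n) :
    proj S p ∈ S ∧ ∀ q ∈ S, inner ℝ (p - proj S p) (q - proj S p) ≤ 0 := by
  have hex : ∃ a, a ∈ S ∧ IsMinOn (fun q => (1 / 2 : ℝ) * ‖p - q‖ ^ 2) S a := by
    obtain ⟨v, hv, hmin⟩ := exists_norm_eq_iInf_of_complete_convex hne hcl.isComplete hconv p
    refine ⟨v, hv, fun q hq => ?_⟩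
    have h1 : ‖p - v‖ ≤ ‖p - q‖ := by
      rw [hmin]
      exact ciInf_le ⟨0, Set.forall_mem_range.2 fun _ => norm_nonneg _⟩ (⟨q, hq⟩ : S)
    simp only [Set.mem_ofPred_eq]
    gcongr
  obtain ⟨hmem, hmin⟩ := Classical.epsilon_spec hex
  change proj S p ∈ S at hmem
  change IsMinOn _ S (proj S p) at hmin
  refine ⟨hmem, (norm_eq_iInf_iff_real_inner_le_zero hconv hmem).1 ?_⟩
  have : Nonempty S := ⟨⟨_, hmem⟩⟩
  refine le_antisymm (le_ciInf fun w => ?_)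
    (ciInf_le ⟨0, Set.forall_mem_range.2 fun _ => norm_nonneg _⟩ (⟨_, hmem⟩ : S))
  have h1 : (1 / 2 : ℝ) * ‖p - proj S p‖ ^ 2 ≤ 1 / 2 * ‖p - w‖ ^ 2 := hmin w.2
  exact le_of_sq_le_sq (by linarith) (norm_nonneg _)

lemma norm_proj_sub_proj_le {m n : ℕ} {S : Set (Pair m n)} (hne : S.Nonempty) (hcl : IsClosed S)
    (hconv : Convex ℝ S) (a b : Pair m n) : ‖proj S a - proj S b‖ ≤ ‖a - b‖ := by
  obtain ⟨ha, ha'⟩ := proj_spec hne hcl hconv a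
  obtain ⟨hb, hb'⟩ := proj_spec hne hcl hconv b
  have h1 := ha' _ hb
  have h2 := hb' _ ha
  have h3 : ‖proj S a - proj S b‖ ^ 2 ≤ inner ℝ (a - b) (proj S a - proj S b) := by
    rw [← real_inner_self_eq_norm_sq]
    have e1 : a - b = (proj S a - proj S b) + (a - proj S a) - (b - proj S b) := by abel
    have e2 : proj S b - proj S a = -(proj S a - proj S b) := by abel
    rw [e2, inner_neg_right] at h1
    conv_rhs => rw [e1, inner_sub_left, inner_add_left]
    linarith
  have h4 := h3.trans (real_inner_le_norm _ _)
  rcases (norm_nonneg (proj S a - proj S b)).eq_or_lt with h0 | h0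
  · rw [← h0]; positivity
  · exact le_of_mul_le_mul_right (by linarith) h0

lemma proj_eq_self {m n : ℕ} {S : Set (Pair m n)} (hcl : IsClosed S)
    (hconv : Convex ℝ S) {p : Pair m n} (hp : p ∈ S) : proj S p = p := by
  have h := (proj_spec ⟨p, hp⟩ hcl hconv p).2 p hp
  rw [real_inner_self_eq_norm_sq] at h
  have : ‖p - proj S p‖ = 0 := by
    have := sq_nonneg ‖p - proj S p‖
    exact pow_eq_zero_iff (two_ne_zero) |>.1 (le_antisymm h this)
  exact (sub_eq_zero.1 (norm_eq_zero.1 this)).symm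

lemma isClosed_Py (dy dh : ℕ) : IsClosed (Py dy dh) := by
  have : Py dy dh = ⋂ i, {p : Pair dy dh | p.snd i ≤ 0} := by ext; simp [Py]
  rw [this]
  refine isClosed_iInter fun i => isClosed_le ?_ continuous_const
  have : Continuous fun p : Pair dy dh => p.snd := WithLp.continuous_snd 2 _ _
  fun_prop

lemma convex_Py (dy dh : ℕ) : Convex ℝ (Py dy dh) := by
  intro p hp q hq a b ha hb _ i
  have h1 := mul_nonpos_of_nonneg_of_nonpos ha (hp i)
  have h2 := mul_nonpos_of_nonneg_of_nonpos hb (hq i)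
  simp only [WithLp.add_snd, WithLp.smul_snd, PiLp.add_apply, PiLp.smul_apply, smul_eq_mul]
  linarith

lemma zero_mem_Py (dy dh : ℕ) : (0 : Pair dy dh) ∈ Py dy dh := fun i => by simp

/-- First-order growth of a strongly convex function. -/
lemma add_inner_add_sq_le_of_strongConvexOn {E : Type*} [NormedAddCommGroup E]
    [InnerProductSpace ℝ E] [CompleteSpace E] {f : E → ℝ} {μ : ℝ}
    (hf : StrongConvexOn Set.univ μ f) {x v : E} (hv : HasGradientAt f v x) (y : E) :
    f x + inner ℝ v (y - x) + μ / 2 * ‖y - x‖ ^ 2 ≤ f y := by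
  have hd : HasDerivAt (fun t : ℝ => f (x + t • (y - x))) (inner ℝ v (y - x)) 0 := by
    have h1 : HasDerivAt (fun t : ℝ => x + t • (y - x)) (y - x) 0 := by
      simpa using ((hasDerivAt_id (0 : ℝ)).smul_const (y - x)).const_add x
    have h2 : HasFDerivAt f (InnerProductSpace.toDual ℝ E v) (x + (0 : ℝ) • (y - x)) := by
      simpa using hv.hasFDerivAt
    have h3 := h2.comp_hasDerivAt 0 h1
    rwa [InnerProductSpace.toDual_apply_apply] at h3
  have hs := hd.tendsto_slope_zero_right
  have hr : Filter.Tendsto (fun t : ℝ => f y - f x - (1 - t) * (μ / 2 * ‖y - x‖ ^ 2))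
      (nhdsWithin 0 (Set.Ioi 0)) (nhds (f y - f x - (1 - 0) * (μ / 2 * ‖y - x‖ ^ 2))) := by
    refine Filter.Tendsto.mono_left ?_ nhdsWithin_le_nhds
    exact Continuous.tendsto (by fun_prop) 0
  have key := le_of_tendsto_of_tendsto hs hr ?_
  · linarith
  · filter_upwards [Ioo_mem_nhdsGT (zero_lt_one : (0 : ℝ) < 1)] with t ht
    have h1 := hf.2 (Set.mem_univ x) (Set.mem_univ y) (sub_nonneg.2 ht.2.le) ht.1.le
      (sub_add_cancel 1 t)
    have e : (1 - t) • x + t • y = x + t • (y - x) := by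
      rw [sub_smul, smul_sub, one_smul]; abel
    rw [e, norm_sub_rev] at h1
    simp only [smul_eq_mul] at h1
    simp only [zero_add, zero_smul, add_zero, smul_eq_mul]
    rw [inv_mul_le_iff₀ ht.1]
    linarith

lemma le_of_gradient_lipschitz {E : Type*} [NormedAddCommGroup E]
    [InnerProductSpace ℝ E] [CompleteSpace E] {f : E → ℝ} {L : ℝ} (hd : Differentiable ℝ f)
    (hL : ∀ a b, ‖gradient f a - gradient f b‖ ≤ L * ‖a - b‖) (x y : E) :
    f x + inner ℝ (gradient f x) (y - x) - L / 2 * ‖y - x‖ ^ 2 ≤ f y := by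
  set F : ℝ → ℝ := fun t => f (x + t • (y - x)) - t * inner ℝ (gradient f x) (y - x)
    + t ^ 2 * (L / 2 * ‖y - x‖ ^ 2) with hF
  have hder : ∀ t : ℝ, HasDerivAt F (inner ℝ (gradient f (x + t • (y - x))) (y - x)
      - inner ℝ (gradient f x) (y - x) + 2 * t * (L / 2 * ‖y - x‖ ^ 2)) t := by
    intro t
    have h1 : HasDerivAt (fun t : ℝ => x + t • (y - x)) (y - x) t := by
      simpa using ((hasDerivAt_id t).smul_const (y - x)).const_add x
    have h2 := (hd (x + t • (y - x))).hasGradientAt.hasFDerivAt.comp_hasDerivAt t h1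
    have h3 := (h2.sub ((hasDerivAt_id t).mul_const (inner ℝ (gradient f x) (y - x)))).add
      ((hasDerivAt_pow 2 t).mul_const (L / 2 * ‖y - x‖ ^ 2))
    simp only [InnerProductSpace.toDual_apply_apply, one_mul, pow_one, Nat.cast_ofNat,
      Nat.add_one_sub_one] at h3
    exact h3
  have hmono : MonotoneOn F (Set.Icc 0 1) := by
    refine monotoneOn_of_deriv_nonneg (convex_Icc 0 1)
      (fun t _ => (hder t).continuousAt.continuousWithinAt)
      (fun t _ => (hder t).differentiableAt.differentiableWithinAt) fun t ht => ?_
    rw [interior_Icc] at ht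
    rw [(hder t).deriv, ← inner_sub_left]
    have h1 := hL (x + t • (y - x)) x
    rw [add_sub_cancel_left, norm_smul, Real.norm_of_nonneg ht.1.le] at h1
    have h2 := neg_le_of_abs_le (abs_real_inner_le_norm
      (gradient f (x + t • (y - x)) - gradient f x) (y - x))
    have h3 : ‖gradient f (x + t • (y - x)) - gradient f x‖ * ‖y - x‖
        ≤ L * (t * ‖y - x‖) * ‖y - x‖ := by gcongr
    nlinarith
  have h := hmono (Set.left_mem_Icc.2 zero_le_one) (Set.right_mem_Icc.2 zero_le_one) zero_le_one
  simp only [hF, zero_smul, add_zero, zero_mul, sub_zero, one_smul, one_mul, one_pow,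
    add_sub_cancel] at h
  linarith

/-- Moving only the second block of a pair sees the second block of the gradient. -/
lemma hasGradientAt_pair_right {m n : ℕ} {q : Pair m n → ℝ} (hq : Differentiable ℝ q) (x : Vec m)
    (y : Vec n) : HasGradientAt (fun y => q (pair x y)) (gradient q (pair x y)).snd y := by
  have h1 : HasFDerivAt (fun y : Vec n => (pair x y : Pair m n))
      ((WithLp.prodContinuousLinearEquiv 2 ℝ (Vec m) (Vec n)).symm.toContinuousLinearMap.comp
        (ContinuousLinearMap.inr ℝ (Vec m) (Vec n))) y :=
    (WithLp.prodContinuousLinearEquiv 2 ℝ (Vec m) (Vec n)).symm.hasFDerivAt.comp y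
      (hasFDerivAt_prodMk_right x y)
  have h2 := (hq (pair x y)).hasGradientAt.hasFDerivAt.comp y h1
  rw [hasGradientAt_iff_hasFDerivAt]
  refine h2.congr_fderiv ?_
  ext d
  simp [-inner_gradient_left, -toDual_gradient]

lemma hasGradientAt_pair_left {m n : ℕ} {q : Pair m n → ℝ} (hq : Differentiable ℝ q) (x : Vec m)
    (y : Vec n) : HasGradientAt (fun x => q (pair x y)) (gradient q (pair x y)).fst x := by
  have h1 : HasFDerivAt (fun x : Vec m => (pair x y : Pair m n))
      ((WithLp.prodContinuousLinearEquiv 2 ℝ (Vec m) (Vec n)).symm.toContinuousLinearMap.comp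
        (ContinuousLinearMap.inl ℝ (Vec m) (Vec n))) x :=
    (WithLp.prodContinuousLinearEquiv 2 ℝ (Vec m) (Vec n)).symm.hasFDerivAt.comp x
      (hasFDerivAt_prodMk_left x y)
  have h2 := (hq (pair x y)).hasGradientAt.hasFDerivAt.comp x h1
  rw [hasGradientAt_iff_hasFDerivAt]
  refine h2.congr_fderiv ?_
  ext d
  simp [-inner_gradient_left, -toDual_gradient]

/-- A lower-level objective: smooth with `L`-Lipschitz gradient and `m`-strongly convex in the
second variable, in first-order form. -/
structure LowerObjective {dx dy : ℕ} (m L : ℝ) (q : Pair dx dy → ℝ) : Prop where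
  differentiable : Differentiable ℝ q
  lip : ∀ a b, ‖gradient q a - gradient q b‖ ≤ L * ‖a - b‖
  growth : ∀ x y₁ y₂, q (pair x y₁) + inner ℝ (gradient q (pair x y₁)).snd (y₂ - y₁)
    + m / 2 * ‖y₂ - y₁‖ ^ 2 ≤ q (pair x y₂)

lemma norm_pair_le {m n : ℕ} (a : Vec m) (b : Vec n) : ‖pair a b‖ ≤ ‖a‖ + ‖b‖ := by
  refine le_of_sq_le_sq ?_ (by positivity)
  rw [WithLp.prod_norm_sq_eq_of_L2]
  simp only [WithLp.toLp_fst, WithLp.toLp_snd]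
  nlinarith [mul_nonneg (norm_nonneg a) (norm_nonneg b)]

lemma norm_fst_le_norm {m n : ℕ} (p : Pair m n) : ‖p.fst‖ ≤ ‖p‖ := WithLp.norm_fst_le _ p

lemma norm_snd_le_norm {m n : ℕ} (p : Pair m n) : ‖p.snd‖ ≤ ‖p‖ := WithLp.norm_snd_le _ p

lemma pair_sub_pair {m n : ℕ} (a a' : Vec m) (b b' : Vec n) :
    pair a b - pair a' b' = pair (a - a') (b - b') := rfl

namespace LowerObjective

variable {dx dy : ℕ} {m L : ℝ} {q : Pair dx dy → ℝ}

lemma lip_pair (h : LowerObjective m L q) (hL : 0 ≤ L) (x₁ x₂ : Vec dx) (y₁ y₂ : Vec dy) :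
    ‖gradient q (pair x₁ y₁) - gradient q (pair x₂ y₂)‖ ≤ L * (‖x₁ - x₂‖ + ‖y₁ - y₂‖) := by
  refine (h.lip _ _).trans ?_
  rw [pair_sub_pair]
  gcongr
  exact norm_pair_le _ _

lemma strongly_monotone (h : LowerObjective m L q) (x : Vec dx) (y₁ y₂ : Vec dy) :
    m * ‖y₁ - y₂‖ ^ 2
      ≤ inner ℝ ((gradient q (pair x y₁)).snd - (gradient q (pair x y₂)).snd) (y₁ - y₂) := by
  have h1 := h.growth x y₁ y₂
  have h2 := h.growth x y₂ y₁
  rw [norm_sub_rev] at h1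
  rw [← neg_sub y₁ y₂, inner_neg_right] at h1
  rw [inner_sub_left]
  linarith

end LowerObjective

namespace Problem

variable {dx dy dh : ℕ} {P : Problem dx dy dh} {lf₀ lf₁ lg₁ : ℝ≥0} {μg : ℝ}

lemma gradient_gδ (h : P.Assumptions lf₀ lf₁ lg₁ μg) (δ : ℝ) (p : Pair dx dy) :
    HasGradientAt (P.gδ δ) (δ • gradient P.f p + gradient P.g p) p := by
  have hf := (h.f_contDiff.differentiable one_ne_zero p).hasGradientAt
  have hg := (h.g_contDiff.differentiable one_ne_zero p).hasGradientAt
  rw [hasGradientAt_iff_hasFDerivAt] at hf hg ⊢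
  refine ((hf.const_mul δ).add hg).congr_fderiv ?_
  ext d
  simp

lemma lowerObjective_g (h : P.Assumptions lf₀ lf₁ lg₁ μg) {m L : ℝ} (hm : m ≤ μg) (hL : lg₁ ≤ L) :
    LowerObjective m L P.g where
  differentiable := h.g_contDiff.differentiable one_ne_zero
  lip a b := by
    have := h.grad_g_lipschitz.dist_le_mul a b
    rw [dist_eq_norm, dist_eq_norm] at this
    exact this.trans (by gcongr)
  growth x y₁ y₂ := by
    have := add_inner_add_sq_le_of_strongConvexOn (h.g_strongConvex x)
      (hasGradientAt_pair_right (h.g_contDiff.differentiable one_ne_zero) x y₁) y₂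
    refine le_trans ?_ this
    gcongr

lemma lowerObjective_gδ (h : P.Assumptions lf₀ lf₁ lg₁ μg) {δ : ℝ} (hδ : 0 ≤ δ)
    (hδμ : 2 * lf₁ * δ ≤ μg) : LowerObjective (μg / 2) (lg₁ + μg / 2) (P.gδ δ) where
  differentiable p := (P.gradient_gδ h δ p).differentiableAt
  lip a b := by
    have hf := h.grad_f_lipschitz.dist_le_mul a b
    have hg := h.grad_g_lipschitz.dist_le_mul a b
    rw [dist_eq_norm, dist_eq_norm] at hf hg
    rw [(P.gradient_gδ h δ a).gradient, (P.gradient_gδ h δ b).gradient, add_sub_add_comm,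
      ← smul_sub]
    have h1 : ‖δ • (gradient P.f a - gradient P.f b)‖ ≤ δ * (lf₁ * ‖a - b‖) := by
      rw [norm_smul, Real.norm_of_nonneg hδ]
      gcongr
    have h2 := norm_add_le (δ • (gradient P.f a - gradient P.f b))
      (gradient P.g a - gradient P.g b)
    have h3 : 2 * lf₁ * δ * ‖a - b‖ ≤ μg * ‖a - b‖ := by gcongr
    linarith
  growth x y₁ y₂ := by
    rw [(P.gradient_gδ h δ _).gradient]
    have h1 := (P.lowerObjective_g h le_rfl le_rfl).growth x y₁ y₂
    have hlip : ∀ a b, ‖gradient P.f a - gradient P.f b‖ ≤ lf₁ * ‖a - b‖ := fun a b => by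
      have hf := h.grad_f_lipschitz.dist_le_mul a b
      rwa [dist_eq_norm, dist_eq_norm] at hf
    have h2 := le_of_gradient_lipschitz (h.f_contDiff.differentiable one_ne_zero) hlip
      (pair x y₁) (pair x y₂)
    have e1 : inner ℝ (gradient P.f (pair x y₁)) (pair x y₂ - pair x y₁)
        = inner ℝ (gradient P.f (pair x y₁)).snd (y₂ - y₁) := by
      rw [pair_sub_pair]; simp [-inner_gradient_left]
    have e2 : ‖pair x y₂ - pair x y₁‖ = ‖y₂ - y₁‖ := by
      rw [pair_sub_pair, sub_self]; exact WithLp.norm_toLp_snd 2 _ _ _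
    rw [e1, e2] at h2
    have h3 := mul_le_mul_of_nonneg_left h2 hδ
    have h4 : 2 * lf₁ * δ * ‖y₂ - y₁‖ ^ 2 ≤ μg * ‖y₂ - y₁‖ ^ 2 := by gcongr
    rw [WithLp.add_snd, WithLp.smul_snd, inner_add_left, inner_smul_left]
    simp only [gδ, conj_trivial]
    linarith

end Problem

/-! ### The saddle problem of the lower level -/

/-- The residual `B x + A y - b - α` of the slack form of the constraint at `p = (y, α)`. -/
def residual {dx dy dh : ℕ} (A : Vec dy →L[ℝ] Vec dh) (B : Vec dx →L[ℝ] Vec dh) (b : Vec dh)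
    (x : Vec dx) (p : Pair dy dh) : Vec dh :=
  B x + A p.fst - b - p.snd

open ContinuousLinearMap in
/-- The gradient in `p = (y, α)` of the augmented Lagrangian
`q(x, y) + uᵀ c + (ρ/2) ‖c‖²`, where `c = B x + A y - b - α`. -/
def primalField {dx dy dh : ℕ} (A : Vec dy →L[ℝ] Vec dh) (B : Vec dx →L[ℝ] Vec dh) (b : Vec dh)
    (ρ : ℝ) (q : Pair dx dy → ℝ) (x : Vec dx) (u : Vec dh) (p : Pair dy dh) : Pair dy dh :=
  pair ((gradient q (pair x p.fst)).snd + adjoint A (u + ρ • residual A B b x p))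
    (-(u + ρ • residual A B b x p))

open ContinuousLinearMap in
/-- The gradient in `x` of the same augmented Lagrangian. -/
def slowField {dx dy dh : ℕ} (A : Vec dy →L[ℝ] Vec dh) (B : Vec dx →L[ℝ] Vec dh) (b : Vec dh)
    (ρ : ℝ) (q : Pair dx dy → ℝ) (x : Vec dx) (u : Vec dh) (p : Pair dy dh) : Vec dx :=
  (gradient q (pair x p.fst)).fst + adjoint B (u + ρ • residual A B b x p)

section Block

variable {dx dy dh : ℕ} {A : Vec dy →L[ℝ] Vec dh} {B : Vec dx →L[ℝ] Vec dh} {b : Vec dh}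
  {ρ m L s : ℝ} {q : Pair dx dy → ℝ}

lemma residual_sub_residual (x₁ x₂ : Vec dx) (p₁ p₂ : Pair dy dh) :
    residual A B b x₁ p₁ - residual A B b x₂ p₂
      = B (x₁ - x₂) + A (p₁ - p₂).fst - (p₁ - p₂).snd := by
  simp only [residual, map_sub, WithLp.sub_fst, WithLp.sub_snd]
  abel

lemma norm_residual_sub_le (x₁ x₂ : Vec dx) (p₁ p₂ : Pair dy dh) :
    ‖residual A B b x₁ p₁ - residual A B b x₂ p₂‖
      ≤ (‖A‖ + ‖B‖ + 1) * (‖x₁ - x₂‖ + ‖p₁ - p₂‖) := by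
  rw [residual_sub_residual]
  have h1 := norm_sub_le (B (x₁ - x₂) + A (p₁ - p₂).fst) (p₁ - p₂).snd
  have h2 := norm_add_le (B (x₁ - x₂)) (A (p₁ - p₂).fst)
  have h3 := B.le_opNorm (x₁ - x₂)
  have h4 : ‖A (p₁ - p₂).fst‖ ≤ ‖A‖ * ‖p₁ - p₂‖ :=
    (A.le_opNorm _).trans (by gcongr; exact norm_fst_le_norm _)
  have h5 := norm_snd_le_norm (p₁ - p₂)
  have h6 : 0 ≤ ‖A‖ * ‖x₁ - x₂‖ := by positivity
  have h7 : 0 ≤ ‖B‖ * ‖p₁ - p₂‖ := by positivity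
  have h8 := norm_nonneg (x₁ - x₂)
  linarith

lemma norm_adjoint_apply_le (u : Vec dh) : ‖ContinuousLinearMap.adjoint A u‖ ≤ ‖A‖ * ‖u‖ := by
  refine (ContinuousLinearMap.le_opNorm _ u).trans ?_
  rw [LinearIsometryEquiv.norm_map]

lemma norm_augmented_multiplier_sub_le (hρ : 0 ≤ ρ) (x₁ x₂ : Vec dx) (u₁ u₂ : Vec dh)
    (p₁ p₂ : Pair dy dh) :
    ‖(u₁ + ρ • residual A B b x₁ p₁) - (u₂ + ρ • residual A B b x₂ p₂)‖
      ≤ (1 + ρ * (‖A‖ + ‖B‖ + 1)) * (‖x₁ - x₂‖ + ‖u₁ - u₂‖ + ‖p₁ - p₂‖) := by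
  have e : (u₁ + ρ • residual A B b x₁ p₁) - (u₂ + ρ • residual A B b x₂ p₂)
      = (u₁ - u₂) + ρ • (residual A B b x₁ p₁ - residual A B b x₂ p₂) := by
    rw [smul_sub]; abel
  rw [e]
  refine (norm_add_le _ _).trans ?_
  rw [norm_smul, Real.norm_of_nonneg hρ]
  have h0 := norm_nonneg (u₁ - u₂)
  have h1 := norm_nonneg (x₁ - x₂)
  have h2 := norm_nonneg (p₁ - p₂)
  have h3 : ρ * ‖residual A B b x₁ p₁ - residual A B b x₂ p₂‖
      ≤ ρ * ((‖A‖ + ‖B‖ + 1) * (‖x₁ - x₂‖ + ‖u₁ - u₂‖ + ‖p₁ - p₂‖)) := by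
    gcongr
    refine (norm_residual_sub_le x₁ x₂ p₁ p₂).trans ?_
    gcongr
    linarith
  linarith

lemma norm_gradient_sub_le (hq : LowerObjective m L q) (hL : 0 ≤ L) (x₁ x₂ : Vec dx)
    (p₁ p₂ : Pair dy dh) :
    ‖gradient q (pair x₁ p₁.fst) - gradient q (pair x₂ p₂.fst)‖
      ≤ L * (‖x₁ - x₂‖ + ‖p₁ - p₂‖) := by
  refine (hq.lip_pair hL _ _ _ _).trans ?_
  have h := norm_fst_le_norm (p₁ - p₂)
  rw [WithLp.sub_fst] at h
  gcongr

lemma norm_primalField_sub_le (hq : LowerObjective m L q) (hL : 0 ≤ L) (hρ : 0 ≤ ρ)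
    (x₁ x₂ : Vec dx) (u₁ u₂ : Vec dh) (p₁ p₂ : Pair dy dh) :
    ‖primalField A B b ρ q x₁ u₁ p₁ - primalField A B b ρ q x₂ u₂ p₂‖
      ≤ (L + (‖A‖ + 1) * (1 + ρ * (‖A‖ + ‖B‖ + 1)))
        * (‖x₁ - x₂‖ + ‖u₁ - u₂‖ + ‖p₁ - p₂‖) := by
  have hw' := norm_augmented_multiplier_sub_le (A := A) (B := B) (b := b) hρ x₁ x₂ u₁ u₂ p₁ p₂
  set S := ‖x₁ - x₂‖ + ‖u₁ - u₂‖ + ‖p₁ - p₂‖ with hS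
  set w := (u₁ + ρ • residual A B b x₁ p₁) - (u₂ + ρ • residual A B b x₂ p₂) with hw
  have e : primalField A B b ρ q x₁ u₁ p₁ - primalField A B b ρ q x₂ u₂ p₂
      = pair ((gradient q (pair x₁ p₁.fst) - gradient q (pair x₂ p₂.fst)).snd
          + ContinuousLinearMap.adjoint A w) (-w) := by
    rw [primalField, primalField, pair_sub_pair, WithLp.sub_snd, hw, map_sub]
    congr 1 <;> abel
  rw [e]
  refine (norm_pair_le _ _).trans ?_
  rw [norm_neg]
  have h1 := norm_add_le (gradient q (pair x₁ p₁.fst) - gradient q (pair x₂ p₂.fst)).snd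
    (ContinuousLinearMap.adjoint A w)
  have h2 := norm_adjoint_apply_le (A := A) w
  have h3 : ‖(gradient q (pair x₁ p₁.fst) - gradient q (pair x₂ p₂.fst)).snd‖ ≤ L * S := by
    refine (norm_snd_le_norm _).trans ((norm_gradient_sub_le hq hL x₁ x₂ p₁ p₂).trans ?_)
    have := norm_nonneg (u₁ - u₂)
    gcongr
    linarith
  have h5 : (‖A‖ + 1) * ‖w‖ ≤ (‖A‖ + 1) * ((1 + ρ * (‖A‖ + ‖B‖ + 1)) * S) := by gcongr
  linarith

lemma norm_slowField_sub_le (hq : LowerObjective m L q) (hL : 0 ≤ L) (hρ : 0 ≤ ρ)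
    (x₁ x₂ : Vec dx) (u₁ u₂ : Vec dh) (p₁ p₂ : Pair dy dh) :
    ‖slowField A B b ρ q x₁ u₁ p₁ - slowField A B b ρ q x₂ u₂ p₂‖
      ≤ (L + ‖B‖ * (1 + ρ * (‖A‖ + ‖B‖ + 1)))
        * (‖x₁ - x₂‖ + ‖u₁ - u₂‖ + ‖p₁ - p₂‖) := by
  have hw' := norm_augmented_multiplier_sub_le (A := A) (B := B) (b := b) hρ x₁ x₂ u₁ u₂ p₁ p₂
  set S := ‖x₁ - x₂‖ + ‖u₁ - u₂‖ + ‖p₁ - p₂‖ with hS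
  set w := (u₁ + ρ • residual A B b x₁ p₁) - (u₂ + ρ • residual A B b x₂ p₂) with hw
  have e : slowField A B b ρ q x₁ u₁ p₁ - slowField A B b ρ q x₂ u₂ p₂
      = (gradient q (pair x₁ p₁.fst) - gradient q (pair x₂ p₂.fst)).fst
          + ContinuousLinearMap.adjoint B w := by
    rw [slowField, slowField, WithLp.sub_fst, hw, map_sub]
    abel
  rw [e]
  refine (norm_add_le _ _).trans ?_
  have h2 := norm_adjoint_apply_le (A := B) w
  have h3 : ‖(gradient q (pair x₁ p₁.fst) - gradient q (pair x₂ p₂.fst)).fst‖ ≤ L * S := by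
    refine (norm_fst_le_norm _).trans ((norm_gradient_sub_le hq hL x₁ x₂ p₁ p₂).trans ?_)
    have := norm_nonneg (u₁ - u₂)
    gcongr
    linarith
  have h5 : ‖B‖ * ‖w‖ ≤ ‖B‖ * ((1 + ρ * (‖A‖ + ‖B‖ + 1)) * S) := by gcongr
  linarith

lemma inner_primalField (x : Vec dx) (u : Vec dh) (p w : Pair dy dh) :
    inner ℝ (primalField A B b ρ q x u p) w
      = inner ℝ (gradient q (pair x p.fst)).snd w.fst
        + inner ℝ (u + ρ • residual A B b x p) (A w.fst - w.snd) := by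
  rw [primalField, WithLp.prod_inner_apply]
  simp only [WithLp.ofLp_fst, WithLp.ofLp_snd, inner_add_left, inner_neg_left,
    ContinuousLinearMap.adjoint_inner_left, inner_sub_right, inner_smul_left]
  ring

/-- The quadratic penalty makes the field strongly monotone in the slack variable too. -/
lemma primalField_strongly_monotone (hq : LowerObjective m L q) {m' : ℝ} (hm' : 0 ≤ m')
    (hm : m' * (1 + 2 * ‖A‖ ^ 2) ≤ m) (hρ : 2 * m' ≤ ρ) (x : Vec dx) (u : Vec dh)
    (p₁ p₂ : Pair dy dh) :
    m' * ‖p₁ - p₂‖ ^ 2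
      ≤ inner ℝ (primalField A B b ρ q x u p₁ - primalField A B b ρ q x u p₂) (p₁ - p₂) := by
  have e1 := residual_sub_residual (A := A) (B := B) (b := b) x x p₁ p₂
  rw [sub_self, map_zero, zero_add] at e1
  set d := p₁ - p₂ with hd
  have h1 : inner ℝ (primalField A B b ρ q x u p₁ - primalField A B b ρ q x u p₂) d
      = inner ℝ ((gradient q (pair x p₁.fst)).snd - (gradient q (pair x p₂.fst)).snd) d.fst
        + ρ * ‖A d.fst - d.snd‖ ^ 2 := by
    rw [inner_sub_left, inner_primalField, inner_primalField, inner_sub_left,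
      ← real_inner_self_eq_norm_sq, ← e1]
    simp only [inner_add_left, real_inner_smul_left, inner_sub_left]
    ring
  have h2 := hq.strongly_monotone x p₁.fst p₂.fst
  rw [← WithLp.sub_fst, ← hd] at h2
  have h3 : ‖d.snd‖ ^ 2 ≤ 2 * ‖A d.fst - d.snd‖ ^ 2 + 2 * (‖A‖ ^ 2 * ‖d.fst‖ ^ 2) := by
    have a1 : ‖d.snd‖ ≤ ‖A d.fst - d.snd‖ + ‖A‖ * ‖d.fst‖ := by
      have := norm_le_norm_add_norm_sub (A d.fst) d.snd
      have := A.le_opNorm d.fst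
      linarith
    have a2 : ‖d.snd‖ ^ 2 ≤ (‖A d.fst - d.snd‖ + ‖A‖ * ‖d.fst‖) ^ 2 := by gcongr
    nlinarith [sq_nonneg (‖A d.fst - d.snd‖ - ‖A‖ * ‖d.fst‖)]
  have h4 := WithLp.prod_norm_sq_eq_of_L2 d
  have h5 : m' * (1 + 2 * ‖A‖ ^ 2) * ‖d.fst‖ ^ 2 ≤ m * ‖d.fst‖ ^ 2 := by gcongr
  have h6 : 2 * m' * ‖A d.fst - d.snd‖ ^ 2 ≤ ρ * ‖A d.fst - d.snd‖ ^ 2 := by gcongr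
  have h7 := mul_le_mul_of_nonneg_left h3 hm'
  rw [h1, h4]
  linarith

lemma mem_Py_and_variational {η : ℝ} (hη : 0 < η) {p t : Pair dy dh}
    (h : proj (Py dy dh) (p - η • t) = p) :
    p ∈ Py dy dh ∧ ∀ w ∈ Py dy dh, 0 ≤ inner ℝ t (w - p) := by
  obtain ⟨h1, h2⟩ := proj_spec ⟨0, zero_mem_Py dy dh⟩ (isClosed_Py dy dh) (convex_Py dy dh)
    (p - η • t)
  rw [h] at h1 h2
  refine ⟨h1, fun w hw => ?_⟩
  have h3 := h2 w hw
  rw [sub_sub_cancel_left, inner_neg_left, inner_smul_left, conj_trivial] at h3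
  exact nonneg_of_mul_nonneg_right (by linarith) hη

/-- Since `y` is unconstrained, the `y`-component of the field vanishes at a solution. -/
lemma stationary_of_variational {x : Vec dx} {u : Vec dh} {p : Pair dy dh} (hp : p ∈ Py dy dh)
    (h : ∀ w ∈ Py dy dh, 0 ≤ inner ℝ (primalField A B b ρ q x u p) (w - p)) :
    (gradient q (pair x p.fst)).snd
      + ContinuousLinearMap.adjoint A (u + ρ • residual A B b x p) = 0 := by
  set v := (gradient q (pair x p.fst)).snd
      + ContinuousLinearMap.adjoint A (u + ρ • residual A B b x p) with hv
  have h1 := h (pair (p.fst - v) p.snd) hp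
  have e : pair (p.fst - v) p.snd - p = pair (-v) 0 := by
    rw [← sub_sub_cancel_left p.fst v, ← sub_self p.snd]; rfl
  rw [e, inner_primalField] at h1
  simp only [WithLp.toLp_fst, WithLp.toLp_snd, sub_zero,
    ← ContinuousLinearMap.adjoint_inner_left] at h1
  rw [← inner_add_left, ← hv, inner_neg_right, real_inner_self_eq_norm_sq] at h1
  have : ‖v‖ ^ 2 = 0 := le_antisymm (by linarith) (sq_nonneg _)
  exact norm_eq_zero.1 (pow_eq_zero_iff two_ne_zero |>.1 this)

/-- Full row rank of `A` bounds the multiplier increment by the primal increment, which turns strong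
monotonicity in `p` into strong concavity in `u`. -/
theorem exists_saddleFamily (A : Vec dy →L[ℝ] Vec dh) (B : Vec dx →L[ℝ] Vec dh) {s ρ m L : ℝ}
    (hs : ∀ u, ‖u‖ ≤ s * ‖ContinuousLinearMap.adjoint A u‖) (hs0 : 0 ≤ s) (hρ : 0 < ρ) (hm : 0 < m)
    (hL : 0 ≤ L) :
    ∃ m' L' : ℝ, 0 < m' ∧ m' ≤ L' ∧ ∀ (b : Vec dh) (q : Pair dx dy → ℝ), LowerObjective m L q →
      SaddleFamily m' L' (primalField A B b ρ q) (residual A B b) (proj (Py dy dh)) := by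
  obtain ⟨N, hN⟩ : ∃ N, N = ‖A‖ + ‖B‖ + 1 := ⟨_, rfl⟩
  have hN0 : 0 < N := by rw [hN]; positivity
  obtain ⟨m₁, hm₁⟩ : ∃ m₁, m₁ = min (m / (1 + 2 * ‖A‖ ^ 2)) (ρ / 2) := ⟨_, rfl⟩
  have hm₁0 : 0 < m₁ := by rw [hm₁]; exact lt_min (by positivity) (by positivity)
  have hm₁m : m₁ * (1 + 2 * ‖A‖ ^ 2) ≤ m := by
    rw [← le_div_iff₀ (by positivity), hm₁]; exact min_le_left _ _
  have hm₁ρ : 2 * m₁ ≤ ρ := by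
    have : m₁ ≤ ρ / 2 := by rw [hm₁]; exact min_le_right _ _
    linarith
  obtain ⟨Q, hQ⟩ : ∃ Q, Q = s * (L + ρ * (‖A‖ * N)) := ⟨_, rfl⟩
  have hQ0 : 0 ≤ Q := by rw [hQ]; positivity
  obtain ⟨m', hm'⟩ : ∃ m', m' = m₁ / (1 + Q ^ 2) := ⟨_, rfl⟩
  have hm'0 : 0 < m' := by rw [hm']; positivity
  have hm'Q : m' * (1 + Q ^ 2) = m₁ := by rw [hm']; field_simp
  have hm'1 : m' ≤ m₁ := by nlinarith [mul_nonneg hm'0.le (sq_nonneg Q)]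
  obtain ⟨L', hL1, hL2, hL3⟩ : ∃ L', m' ≤ L' ∧ N ≤ L' ∧ L + (‖A‖ + 1) * (1 + ρ * N) ≤ L' := by
    refine ⟨m' + N + (L + (‖A‖ + 1) * (1 + ρ * N)), ?_⟩
    have : 0 ≤ L + (‖A‖ + 1) * (1 + ρ * N) := by positivity
    refine ⟨?_, ?_, ?_⟩ <;> linarith
  have hL'0 : 0 < L' := hm'0.trans_le hL1
  refine ⟨m', L', hm'0, hL1, fun b q hq => ?_⟩
  constructor
  · exact norm_proj_sub_proj_le ⟨0, zero_mem_Py dy dh⟩ (isClosed_Py dy dh) (convex_Py dy dh)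
  · intro x u p₁ p₂
    refine le_trans ?_ (primalField_strongly_monotone hq hm₁0.le hm₁m hm₁ρ x u p₁ p₂)
    gcongr
  · intro x₁ x₂ u₁ u₂ p₁ p₂
    refine (norm_primalField_sub_le hq hL hρ.le x₁ x₂ u₁ u₂ p₁ p₂).trans ?_
    rw [← hN]
    gcongr
  · intro x₁ x₂ p₁ p₂
    refine (norm_residual_sub_le x₁ x₂ p₁ p₂).trans ?_
    rw [← hN]
    gcongr
  · intro x u₁ u₂ p₁ p₂ h₁ h₂
    obtain ⟨hp₁, hv₁⟩ := mem_Py_and_variational (by positivity) h₁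
    obtain ⟨hp₂, hv₂⟩ := mem_Py_and_variational (by positivity) h₂
    have hst₁ := stationary_of_variational hp₁ hv₁
    have hst₂ := stationary_of_variational hp₂ hv₂
    have hmono := primalField_strongly_monotone (A := A) (B := B) (b := b) hq hm₁0.le hm₁m hm₁ρ x u₂
      p₁ p₂
    have e1 := residual_sub_residual (A := A) (B := B) (b := b) x x p₁ p₂
    rw [sub_self, map_zero, zero_add] at e1
    have hres := norm_residual_sub_le (A := A) (B := B) (b := b) x x p₁ p₂
    rw [sub_self, norm_zero, zero_add, ← hN] at hres
    have key : m₁ * ‖p₁ - p₂‖ ^ 2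
        ≤ inner ℝ (residual A B b x p₂ - residual A B b x p₁) (u₁ - u₂) := by
      have a1 := hv₁ p₂ hp₂
      have a2 := hv₂ p₁ hp₁
      rw [← neg_sub p₁ p₂, inner_neg_right] at a1
      have a3 : inner ℝ (primalField A B b ρ q x u₁ p₁) (p₁ - p₂)
          = inner ℝ (primalField A B b ρ q x u₂ p₁) (p₁ - p₂)
            + inner ℝ (u₁ - u₂) (residual A B b x p₁ - residual A B b x p₂) := by
        rw [inner_primalField, inner_primalField, e1, inner_add_left, inner_add_left,
          inner_sub_left]
        ring
      rw [inner_sub_left] at hmono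
      rw [← neg_sub (residual A B b x p₁), inner_neg_left, real_inner_comm]
      linarith
    have hu : ‖u₁ - u₂‖ ≤ Q * ‖p₁ - p₂‖ := by
      have b1 : ContinuousLinearMap.adjoint A (u₁ - u₂)
          = -((gradient q (pair x p₁.fst) - gradient q (pair x p₂.fst)).snd
            + ρ • ContinuousLinearMap.adjoint A (residual A B b x p₁ - residual A B b x p₂)) := by
        have := congrArg₂ (· - ·) hst₁ hst₂
        simp only [map_add, map_smul, sub_zero] at this
        rw [eq_neg_iff_add_eq_zero, ← this, WithLp.sub_snd, map_sub, map_sub, smul_sub]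
        abel
      have b2 : ‖ContinuousLinearMap.adjoint A (u₁ - u₂)‖
          ≤ (L + ρ * (‖A‖ * N)) * ‖p₁ - p₂‖ := by
        rw [b1, norm_neg]
        refine (norm_add_le _ _).trans ?_
        rw [norm_smul, Real.norm_of_nonneg hρ.le]
        have c1 : ‖(gradient q (pair x p₁.fst) - gradient q (pair x p₂.fst)).snd‖
            ≤ L * ‖p₁ - p₂‖ := by
          have := norm_gradient_sub_le hq hL x x p₁ p₂
          rw [sub_self, norm_zero, zero_add] at this
          exact (norm_snd_le_norm _).trans this
        have c2 : ρ * ‖ContinuousLinearMap.adjoint A (residual A B b x p₁ - residual A B b x p₂)‖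
            ≤ ρ * (‖A‖ * (N * ‖p₁ - p₂‖)) := by
          gcongr
          exact (norm_adjoint_apply_le _).trans (by gcongr)
        linarith
      calc _ ≤ _ := hs _
        _ ≤ s * ((L + ρ * (‖A‖ * N)) * ‖p₁ - p₂‖) := by gcongr
        _ = Q * ‖p₁ - p₂‖ := by rw [hQ]; ring
    refine le_trans ?_ key
    have hu2 : ‖u₁ - u₂‖ ^ 2 ≤ (Q * ‖p₁ - p₂‖) ^ 2 := by gcongr
    calc m' * ‖u₁ - u₂‖ ^ 2 ≤ m' * (Q * ‖p₁ - p₂‖) ^ 2 := by gcongr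
      _ ≤ m' * (1 + Q ^ 2) * ‖p₁ - p₂‖ ^ 2 := by
        have : 0 ≤ m' * ‖p₁ - p₂‖ ^ 2 := by positivity
        linarith
      _ = _ := by rw [hm'Q]

end Block

/-! ### Optimality conditions and the lower-level value function -/

section KKT

variable {dx dy dh : ℕ} {A : Vec dy →L[ℝ] Vec dh} {B : Vec dx →L[ℝ] Vec dh} {b : Vec dh}
  {ρ m L s : ℝ} {q : Pair dx dy → ℝ}

/-- The Karush–Kuhn–Tucker conditions for minimizing `q(x, ·)` subject to `B x + A y - b ≤ 0`. -/
structure IsKKT (A : Vec dy →L[ℝ] Vec dh) (B : Vec dx →L[ℝ] Vec dh) (b : Vec dh)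
    (q : Pair dx dy → ℝ) (x : Vec dx) (y : Vec dy) (u : Vec dh) : Prop where
  feasible : ∀ i, (B x + A y - b) i ≤ 0
  nonneg : ∀ i, 0 ≤ u i
  compl : inner ℝ u (B x + A y - b) = 0
  stationary : (gradient q (pair x y)).snd + ContinuousLinearMap.adjoint A u = 0

lemma inner_nonpos_of_nonneg_of_nonpos {n : ℕ} {u w : Vec n} (hu : ∀ i, 0 ≤ u i)
    (hw : ∀ i, w i ≤ 0) : inner ℝ u w ≤ 0 := by
  rw [PiLp.inner_apply]
  refine Finset.sum_nonpos fun i _ => ?_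
  simpa using mul_nonpos_of_nonpos_of_nonneg (hw i) (hu i)

/-- A feasible solution of the projected primal equation is a KKT point: the slack variable carries
the sign of the multiplier and the complementarity. -/
lemma isKKT_of_fixed {η : ℝ} (hη : 0 < η) {x : Vec dx} {u : Vec dh} {p : Pair dy dh}
    (hfix : proj (Py dy dh) (p - η • primalField A B b ρ q x u p) = p)
    (hres : residual A B b x p = 0) : IsKKT A B b q x p.fst u := by
  obtain ⟨hp, hv⟩ := mem_Py_and_variational hη hfix
  have hst := stationary_of_variational hp hv
  rw [hres, smul_zero, add_zero] at hst
  have hsnd : B x + A p.fst - b = p.snd := sub_eq_zero.1 hres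
  have hslack : ∀ w : Vec dh, (∀ i, w i ≤ 0) → inner ℝ u (w - p.snd) ≤ 0 := fun w hw => by
    have h1 := hv (pair p.fst w) hw
    have e : pair p.fst w - p = pair 0 (w - p.snd) := by
      rw [← sub_self p.fst]; rfl
    rw [e, inner_primalField, hres] at h1
    simp only [WithLp.toLp_fst, WithLp.toLp_snd, inner_zero_right, map_zero, smul_zero, add_zero,
      zero_add, zero_sub, inner_neg_right] at h1
    linarith
  refine ⟨fun i => by rw [hsnd]; exact hp i, fun i => ?_, ?_, hst⟩
  · have h1 := hslack (p.snd - EuclideanSpace.single i 1) fun j => by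
      have := hp j
      by_cases h : j = i
      · subst h; simp; linarith
      · simp [h]; linarith
    rw [sub_sub_cancel_left, inner_neg_right, EuclideanSpace.inner_single_right] at h1
    simpa using h1
  · rw [hsnd]
    have h1 := hslack 0 fun j => by simp
    have h2 := hslack ((2 : ℝ) • p.snd) fun j => by
      have := hp j
      simp only [PiLp.smul_apply, smul_eq_mul]; linarith
    rw [zero_sub, inner_neg_right] at h1
    rw [two_smul, add_sub_cancel_right] at h2
    linarith

namespace IsKKT

lemma inner_gradient_eq {x : Vec dx} {y : Vec dy} {u : Vec dh} (h : IsKKT A B b q x y u)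
    (y' : Vec dy) :
    inner ℝ (gradient q (pair x y)).snd (y' - y) = - inner ℝ u (B x + A y' - b) := by
  rw [eq_neg_of_add_eq_zero_left h.stationary, inner_neg_left,
    ContinuousLinearMap.adjoint_inner_left]
  have e : A (y' - y) = (B x + A y' - b) - (B x + A y - b) := by rw [map_sub]; abel
  rw [e, inner_sub_right, h.compl, sub_zero]

lemma growth {x : Vec dx} {y y' : Vec dy} {u : Vec dh} (h : IsKKT A B b q x y u)
    (hq : LowerObjective m L q) (hy' : ∀ i, (B x + A y' - b) i ≤ 0) :
    q (pair x y) + m / 2 * ‖y' - y‖ ^ 2 ≤ q (pair x y') := by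
  have h1 := hq.growth x y y'
  have h2 := h.inner_gradient_eq y'
  have h3 := inner_nonpos_of_nonneg_of_nonpos h.nonneg hy'
  linarith

/-- The Lagrangian at `u₁` minorizes the objective on feasible points, so the value function lies
above its first-order model at `x₁` up to a quadratic error. -/
lemma le_of_feasible {x₁ x₂ : Vec dx} {y₁ y₂ : Vec dy} {u₁ : Vec dh} (h : IsKKT A B b q x₁ y₁ u₁)
    (hq : LowerObjective m L q) (hy₂ : ∀ i, (B x₂ + A y₂ - b) i ≤ 0) :
    q (pair x₁ y₁)
      + inner ℝ ((gradient q (pair x₁ y₁)).fst + ContinuousLinearMap.adjoint B u₁) (x₂ - x₁)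
      - L / 2 * (‖x₂ - x₁‖ ^ 2 + ‖y₂ - y₁‖ ^ 2) ≤ q (pair x₂ y₂) := by
  have h1 := le_of_gradient_lipschitz hq.differentiable hq.lip (pair x₁ y₁) (pair x₂ y₂)
  rw [pair_sub_pair, WithLp.prod_norm_sq_eq_of_L2, WithLp.prod_inner_apply] at h1
  simp only [WithLp.ofLp_fst, WithLp.ofLp_snd, WithLp.toLp_fst, WithLp.toLp_snd] at h1
  have h2 : inner ℝ (gradient q (pair x₁ y₁)).snd (y₂ - y₁)
      = inner ℝ (ContinuousLinearMap.adjoint B u₁) (x₂ - x₁)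
        - inner ℝ u₁ (B x₂ + A y₂ - b) := by
    rw [eq_neg_of_add_eq_zero_left h.stationary, inner_neg_left,
      ContinuousLinearMap.adjoint_inner_left, ContinuousLinearMap.adjoint_inner_left]
    have e : A (y₂ - y₁) = (B x₂ + A y₂ - b) - (B x₁ + A y₁ - b) - B (x₂ - x₁) := by
      rw [map_sub, map_sub]; abel
    rw [e, inner_sub_right, inner_sub_right, h.compl]
    ring
  have h3 := inner_nonpos_of_nonneg_of_nonpos h.nonneg hy₂
  rw [inner_add_left]
  linarith

end IsKKT

/-- The lower-level solution `(yS x, uS x)` with an energy `E x p u` for the distance of the primal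
and dual iterates to it, the gradient error it controls, and the quadratic expansion of the
lower-level value function. -/
structure BlockEnergy (η ηu γ C : ℝ) (A : Vec dy →L[ℝ] Vec dh) (B : Vec dx →L[ℝ] Vec dh)
    (b : Vec dh) (ρ : ℝ) (q : Pair dx dy → ℝ) (yS : Vec dx → Vec dy) (uS : Vec dx → Vec dh)
    (E : Vec dx → Pair dy dh → Vec dh → ℝ) : Prop where
  kkt : ∀ x, IsKKT A B b q x (yS x) (uS x)
  lip_yS : ∀ x₁ x₂, ‖yS x₁ - yS x₂‖ ≤ C * ‖x₁ - x₂‖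
  nonneg : ∀ x p u, 0 ≤ E x p u
  contract : ∀ x p u,
    E x (proj (Py dy dh) (p - η • primalField A B b ρ q x (u + ηu • residual A B b x p) p))
      (u + ηu • residual A B b x p) ≤ (1 - γ) * E x p u
  drift : ∀ x₁ x₂ p u, E x₁ p u ≤ E x₂ p u + C * ‖x₁ - x₂‖
  le_dist : ∀ x p u, E x p u
    ≤ C * (‖p.fst - yS x‖ + ‖u - uS x‖ + ‖p.snd - (B x + A p.fst - b)‖)
  le_norm : ∀ x p u, p ∈ Py dy dh →
    E x p u ≤ C * (‖gradient q 0‖ + ‖b‖ + ‖x‖ + ‖u‖ + ‖p‖)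
  slow_le : ∀ x p u, ‖slowField A B b ρ q x (u + ηu • residual A B b x p) p
    - ((gradient q (pair x (yS x))).fst + ContinuousLinearMap.adjoint B (uS x))‖ ≤ C * E x p u
  expansion : ∀ x₁ x₂, |q (pair x₂ (yS x₂)) - q (pair x₁ (yS x₁))
    - inner ℝ ((gradient q (pair x₁ (yS x₁))).fst + ContinuousLinearMap.adjoint B (uS x₁))
      (x₂ - x₁)| ≤ C * ‖x₂ - x₁‖ ^ 2

theorem exists_blockEnergy (A : Vec dy →L[ℝ] Vec dh) (B : Vec dx →L[ℝ] Vec dh) {s ρ m L : ℝ}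
    (hs : ∀ u, ‖u‖ ≤ s * ‖ContinuousLinearMap.adjoint A u‖) (hs0 : 0 ≤ s) (hρ : 0 < ρ) (hm : 0 < m)
    (hL : 0 ≤ L) :
    ∃ η ηu γ C : ℝ, 0 < η ∧ 0 < ηu ∧ 0 < γ ∧ γ ≤ 1 ∧ 0 < C ∧
      ∀ (b : Vec dh) (q : Pair dx dy → ℝ), LowerObjective m L q →
        ∃ yS uS E, BlockEnergy η ηu γ C A B b ρ q yS uS E := by
  obtain ⟨m', L', hm', hmL', hfam⟩ := exists_saddleFamily A B hs hs0 hρ hm hL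
  have hL' : 0 < L' := hm'.trans_le hmL'
  obtain ⟨ηu, γ, C₀, hηu, hγ, hγ1, hC₀, htr⟩ :=
    SaddleFamily.exists_trackingEnergy (X := Vec dx) (P := Pair dy dh) (U := Vec dh) hm' hmL'
  obtain ⟨K, hK⟩ : ∃ K, K = L + ‖B‖ * (1 + ρ * (‖A‖ + ‖B‖ + 1)) := ⟨_, rfl⟩
  have hK0 : 0 ≤ K := by rw [hK]; positivity
  obtain ⟨Q, hQ⟩ : ∃ Q, Q = L / 2 * (1 + C₀ ^ 2) + K * (1 + 2 * C₀) := ⟨_, rfl⟩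
  have hQ0 : 0 ≤ Q := by rw [hQ]; positivity
  obtain ⟨N, hN⟩ : ∃ N, N = 2 + (‖A‖ + 1) * ρ + 2 * L' := ⟨_, rfl⟩
  have hN0 : 0 ≤ N := by rw [hN]; positivity
  obtain ⟨C, hC1, hC2, hC3, hC4, hC5⟩ : ∃ C, C₀ ≤ C ∧ C₀ * (2 + ‖A‖) ≤ C ∧ C₀ * N ≤ C ∧
      K * (2 * C₀) ≤ C ∧ Q ≤ C := by
    refine ⟨C₀ + C₀ * (2 + ‖A‖) + C₀ * N + K * (2 * C₀) + Q, ?_⟩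
    have : 0 ≤ C₀ * (2 + ‖A‖) := by positivity
    have : 0 ≤ C₀ * N := by positivity
    have : 0 ≤ K * (2 * C₀) := by positivity
    refine ⟨?_, ?_, ?_, ?_, ?_⟩ <;> linarith
  refine ⟨m' / L' ^ 2, ηu, γ, C, by positivity, hηu, hγ, hγ1, hC₀.trans_le hC1, fun b q hq => ?_⟩
  have hf := hfam b q hq
  obtain ⟨pS, uS, E, hE⟩ := htr _ _ _ hf
  have hkkt : ∀ x, IsKKT A B b q x (pS x).fst (uS x) := fun x =>
    isKKT_of_fixed (by positivity) (hE.fixed x) (hE.feasible x)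
  have hslow : ∀ x, slowField A B b ρ q x (uS x) (pS x)
      = (gradient q (pair x (pS x).fst)).fst + ContinuousLinearMap.adjoint B (uS x) := fun x => by
    rw [slowField, hE.feasible, smul_zero, add_zero]
  have hlipy : ∀ x₁ x₂, ‖(pS x₁).fst - (pS x₂).fst‖ ≤ C₀ * ‖x₁ - x₂‖ := fun x₁ x₂ => by
    rw [← WithLp.sub_fst]
    exact (norm_fst_le_norm _).trans (hE.lip_pS x₁ x₂)
  have hlower : ∀ x₁ x₂, q (pair x₁ (pS x₁).fst)
      + inner ℝ (slowField A B b ρ q x₁ (uS x₁) (pS x₁)) (x₂ - x₁)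
      - L / 2 * (1 + C₀ ^ 2) * ‖x₂ - x₁‖ ^ 2 ≤ q (pair x₂ (pS x₂).fst) := fun x₁ x₂ => by
    rw [hslow]
    have h1 := (hkkt x₁).le_of_feasible hq (hkkt x₂).feasible
    have h2 : ‖(pS x₂).fst - (pS x₁).fst‖ ^ 2 ≤ (C₀ * ‖x₂ - x₁‖) ^ 2 := by
      gcongr
      exact hlipy x₂ x₁
    have h3 : L / 2 * ‖(pS x₂).fst - (pS x₁).fst‖ ^ 2 ≤ L / 2 * (C₀ * ‖x₂ - x₁‖) ^ 2 := by
      gcongr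
    linarith
  refine ⟨fun x => (pS x).fst, uS, E, ?_⟩
  constructor
  · exact hkkt
  · exact fun x₁ x₂ => (hlipy x₁ x₂).trans (by gcongr)
  · exact hE.nonneg
  · exact hE.contract
  · intro x₁ x₂ p u
    refine (hE.drift x₁ x₂ p u).trans ?_
    gcongr
  · intro x p u
    have h1 := hE.le_dist x p u
    have h2 : ‖p - pS x‖ ≤ (2 + ‖A‖) *
        (‖p.fst - (pS x).fst‖ + ‖p.snd - (B x + A p.fst - b)‖) := by
      have a1 := norm_pair_le (p.fst - (pS x).fst) (p.snd - (pS x).snd)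
      rw [← pair_sub_pair] at a1
      have e : p.snd - (pS x).snd = (p.snd - (B x + A p.fst - b)) + A (p.fst - (pS x).fst) := by
        rw [map_sub, ← sub_eq_zero.1 (hE.feasible x)]; abel
      have a2 := norm_add_le (p.snd - (B x + A p.fst - b)) (A (p.fst - (pS x).fst))
      rw [← e] at a2
      have a3 := A.le_opNorm (p.fst - (pS x).fst)
      have a4 : 0 ≤ (1 + ‖A‖) * ‖p.snd - (B x + A p.fst - b)‖ := by positivity
      have a5 := norm_nonneg (p.fst - (pS x).fst)
      change ‖p - pS x‖ ≤ _ at a1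
      linarith
    have h3 : C₀ * ‖p - pS x‖ ≤ C₀ * ((2 + ‖A‖) *
        (‖p.fst - (pS x).fst‖ + ‖p.snd - (B x + A p.fst - b)‖)) := by gcongr
    have h4 : C₀ * (2 + ‖A‖) * (‖p.fst - (pS x).fst‖ + ‖p.snd - (B x + A p.fst - b)‖)
        ≤ C * (‖p.fst - (pS x).fst‖ + ‖p.snd - (B x + A p.fst - b)‖) := by gcongr
    have h5 : C₀ * ‖u - uS x‖ ≤ C * ‖u - uS x‖ := by gcongr
    linarith
  · intro x p u hp
    have h1 := hE.le_residual x p u (proj_eq_self (isClosed_Py dy dh) (convex_Py dy dh) hp)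
    have hr0 : residual A B b 0 (0 : Pair dy dh) = -b := by simp [residual]
    have h2 := hf.lip x 0 u 0 p 0
    have h3 := hf.lip_c x 0 p 0
    simp only [sub_zero] at h2 h3
    rw [hr0] at h3
    have h4 : ‖primalField A B b ρ q 0 0 0‖ ≤ ‖gradient q 0‖ + (‖A‖ + 1) * ρ * ‖b‖ := by
      rw [primalField, hr0]
      refine (norm_pair_le _ _).trans ?_
      rw [norm_neg, zero_add]
      have a1 := norm_adjoint_apply_le (A := A) (ρ • -b)
      have a2 : ‖ρ • -b‖ = ρ * ‖b‖ := by rw [norm_smul, norm_neg, Real.norm_of_nonneg hρ.le]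
      have a3 := norm_add_le (gradient q (pair 0 (0 : Pair dy dh).fst)).snd
        (ContinuousLinearMap.adjoint A (ρ • -b))
      have a4 : ‖(gradient q (pair 0 (0 : Pair dy dh).fst)).snd‖ ≤ ‖gradient q 0‖ :=
        norm_snd_le_norm _
      rw [a2] at a1 ⊢
      linarith
    have h5 := norm_le_norm_add_norm_sub' (primalField A B b ρ q x u p)
      (primalField A B b ρ q 0 0 0)
    have h6 := norm_le_norm_add_norm_sub' (residual A B b x p) (-b)
    rw [norm_neg] at h6
    set S := ‖gradient q 0‖ + ‖b‖ + ‖x‖ + ‖u‖ + ‖p‖ with hS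
    have h7 : ‖primalField A B b ρ q x u p‖ + ‖residual A B b x p‖ ≤ N * S := by
      have b1 := norm_nonneg (gradient q 0)
      have b2 := norm_nonneg b
      have b3 := norm_nonneg x
      have b4 := norm_nonneg u
      have b5 := norm_nonneg p
      have c1 : L' * (‖x‖ + ‖u‖ + ‖p‖) ≤ L' * S := by gcongr; linarith
      have c2 : L' * (‖x‖ + ‖p‖) ≤ L' * S := by gcongr; linarith
      have c3 : (‖A‖ + 1) * ρ * ‖b‖ ≤ (‖A‖ + 1) * ρ * S := by gcongr; linarith
      have c4 : ‖gradient q 0‖ ≤ S := by linarith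
      have c5 : ‖b‖ ≤ S := by linarith
      rw [hN]
      linarith
    have hS0 : 0 ≤ S := by positivity
    calc _ ≤ _ := h1
      _ ≤ C₀ * (N * S) := by gcongr
      _ = C₀ * N * S := by ring
      _ ≤ _ := by gcongr
  · intro x p u
    rw [← hslow]
    refine (norm_slowField_sub_le hq hL hρ.le x x _ _ _ _).trans ?_
    rw [sub_self, norm_zero, zero_add, ← hK]
    have h1 := hE.primal_le x p u
    have h2 := hE.dual_le x p u
    have h0 := hE.nonneg x p u
    calc _ ≤ K * (C₀ * E x p u + C₀ * E x p u) := by gcongr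
      _ = K * (2 * C₀) * E x p u := by ring
      _ ≤ _ := by gcongr
  · intro x₁ x₂
    rw [← hslow]
    have h1 := hlower x₁ x₂
    have h2 := hlower x₂ x₁
    rw [← neg_sub x₂ x₁, norm_neg, inner_neg_right] at h2
    have h3 : inner ℝ (slowField A B b ρ q x₂ (uS x₂) (pS x₂)) (x₂ - x₁)
        ≤ inner ℝ (slowField A B b ρ q x₁ (uS x₁) (pS x₁)) (x₂ - x₁)
          + K * (1 + 2 * C₀) * ‖x₂ - x₁‖ ^ 2 := by
      have a1 := real_inner_le_norm (slowField A B b ρ q x₂ (uS x₂) (pS x₂)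
        - slowField A B b ρ q x₁ (uS x₁) (pS x₁)) (x₂ - x₁)
      have a2 := norm_slowField_sub_le (A := A) (B := B) (b := b) hq hL hρ.le x₂ x₁ (uS x₂) (uS x₁)
        (pS x₂) (pS x₁)
      rw [← hK] at a2
      have a3 : ‖slowField A B b ρ q x₂ (uS x₂) (pS x₂)
          - slowField A B b ρ q x₁ (uS x₁) (pS x₁)‖ ≤ K * ((1 + 2 * C₀) * ‖x₂ - x₁‖) := by
        refine a2.trans ?_
        gcongr
        have := hE.lip_pS x₂ x₁
        have := hE.lip_uS x₂ x₁
        linarith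
      have a4 := mul_le_mul_of_nonneg_right a3 (norm_nonneg (x₂ - x₁))
      rw [inner_sub_left] at a1
      linarith
    have h4 : Q * ‖x₂ - x₁‖ ^ 2 ≤ C * ‖x₂ - x₁‖ ^ 2 := by gcongr
    have h5 : 0 ≤ K * (1 + 2 * C₀) * ‖x₂ - x₁‖ ^ 2 := by positivity
    rw [hQ] at h4
    rw [abs_le]
    constructor <;> linarith

end KKT

/-! ### Inexact gradient descent with a contracting error -/

/-- If the gradient error is controlled by an energy `e` that contracts up to the length of the
slow step, then `F + e²` decreases by a multiple of `‖G‖²` at each step. -/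
lemma card_mul_sq_le_of_inexact_descent {X : Type*} [NormedAddCommGroup X] [InnerProductSpace ℝ X]
    {F : X → ℝ} {G : X → X} {C γ η : ℝ} (hγ : 0 < γ) (hγ1 : γ ≤ 1) (hη : 0 < η)
    (hη1 : η * C ^ 2 ≤ 2 * γ) (hη2 : η * (C + C ^ 2 / γ) ≤ 1 / 2)
    (hF : ∀ a b, F b ≤ F a + inner ℝ (G a) (b - a) + C * ‖b - a‖ ^ 2)
    {x d : ℕ → X} {e : ℕ → ℝ} (hx : ∀ t, x (t + 1) = x t - η • d t) (he0 : ∀ t, 0 ≤ e t)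
    (hd : ∀ t, ‖d t - G (x t)‖ ≤ C * e t)
    (he : ∀ t, e (t + 1) ≤ (1 - γ) * e t + C * ‖x (t + 1) - x t‖) {low r : ℝ}
    (hlow : ∀ a, low ≤ F a) (hr : 0 ≤ r) (T : ℕ) (hT : ∀ t < T, r ≤ ‖G (x t)‖) :
    T * (η / 2 * r ^ 2) ≤ F (x 0) - low + e 0 ^ 2 := by
  have key : ∀ t, η / 2 * ‖G (x t)‖ ^ 2 + F (x (t + 1)) + e (t + 1) ^ 2
      ≤ F (x t) + e t ^ 2 := fun t => by
    have h1 := hF (x t) (x (t + 1))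
    have h2 : x (t + 1) - x t = -(η • d t) := by rw [hx]; abel
    have h3 := he t
    rw [h2, norm_neg, norm_smul, Real.norm_of_nonneg hη.le] at h1 h3
    rw [inner_neg_right, inner_smul_right] at h1
    have h4 : ‖d t - G (x t)‖ ^ 2 ≤ C ^ 2 * e t ^ 2 := by
      rw [← mul_pow]; exact pow_le_pow_left₀ (norm_nonneg _) (hd t) 2
    rw [norm_sub_sq_real, real_inner_comm] at h4
    -- Convexity of the square, with weights `1 - γ` and `γ`.
    have h5 : e (t + 1) ^ 2 ≤ (1 - γ) * e t ^ 2 + η ^ 2 * (C ^ 2 / γ) * ‖d t‖ ^ 2 := by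
      have a1 : e (t + 1) ^ 2 ≤ ((1 - γ) * e t + C * (η * ‖d t‖)) ^ 2 :=
        pow_le_pow_left₀ (he0 _) h3 2
      have a2 : η ^ 2 * (C ^ 2 / γ) * ‖d t‖ ^ 2 = γ * (C * (η * ‖d t‖) / γ) ^ 2 := by
        field_simp
      have a3 : C * (η * ‖d t‖) = γ * (C * (η * ‖d t‖) / γ) := by field_simp
      rw [a2]
      rw [a3] at a1
      set c := C * (η * ‖d t‖) / γ
      have a4 : 0 ≤ γ * (1 - γ) * (e t - c) ^ 2 :=
        mul_nonneg (mul_nonneg hγ.le (by linarith)) (sq_nonneg _)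
      nlinarith
    have h6 : η * C ^ 2 * e t ^ 2 ≤ 2 * γ * e t ^ 2 := by gcongr
    have h7 : η * (η * (C + C ^ 2 / γ)) * ‖d t‖ ^ 2 ≤ η * (1 / 2) * ‖d t‖ ^ 2 := by gcongr
    have h8 := mul_le_mul_of_nonneg_left h4 hη.le
    nlinarith
  have hsum : ∀ t ≤ T, t * (η / 2 * r ^ 2) + F (x t) + e t ^ 2 ≤ F (x 0) + e 0 ^ 2 := by
    intro t
    induction t with
    | zero => intro _; simp
    | succ t ih =>
      intro ht
      have h1 := ih (by omega)
      have h2 := key t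
      have h3 : η / 2 * r ^ 2 ≤ η / 2 * ‖G (x t)‖ ^ 2 := by
        have := hT t (by omega)
        gcongr
      push_cast
      linarith
  have h1 := hsum T le_rfl
  have h2 := hlow (x T)
  have h3 := sq_nonneg (e T)
  linarith

lemma hasGradientAt_of_quadratic_error {X : Type*} [NormedAddCommGroup X] [InnerProductSpace ℝ X]
    [CompleteSpace X] {F : X → ℝ} {v a : X} {C : ℝ}
    (h : ∀ b, |F b - F a - inner ℝ v (b - a)| ≤ C * ‖b - a‖ ^ 2) : HasGradientAt F v a := by
  rw [hasGradientAt_iff_isLittleO]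
  have h1 : (fun b => F b - F a - inner ℝ v (b - a)) =O[nhds a] fun b => ‖b - a‖ ^ 2 :=
    Asymptotics.IsBigO.of_bound C (Filter.Eventually.of_forall fun b => by
      simpa using h b)
  refine h1.trans_isLittleO ?_
  have h2 : Filter.Tendsto (fun b : X => b - a) (nhds a) (nhds 0) := by
    simpa using (continuous_sub_right a).tendsto a
  have h3 := (Asymptotics.isLittleO_norm_pow_id (E' := X) one_lt_two).comp_tendsto h2
  exact h3

/-! ### The gradients of the augmented Lagrangian -/

section Augmented

variable {dx dy dh : ℕ} {A : Vec dy →L[ℝ] Vec dh} {B : Vec dx →L[ℝ] Vec dh} {b : Vec dh}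
  {ρ : ℝ} {q : Pair dx dy → ℝ}

/-- The augmented Lagrangian of one lower-level problem in slack form. -/
def augmented (A : Vec dy →L[ℝ] Vec dh) (B : Vec dx →L[ℝ] Vec dh) (b : Vec dh) (ρ : ℝ)
    (q : Pair dx dy → ℝ) (x : Vec dx) (u : Vec dh) (p : Pair dy dh) : ℝ :=
  q (pair x p.fst) + inner ℝ u (residual A B b x p) + ρ / 2 * ‖residual A B b x p‖ ^ 2

lemma hasGradientAt_augmented_left (hq : Differentiable ℝ q) (x : Vec dx) (u : Vec dh)
    (p : Pair dy dh) :
    HasGradientAt (fun x => augmented A B b ρ q x u p) (slowField A B b ρ q x u p) x := by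
  have h1 := (hasGradientAt_pair_left hq x p.fst).hasFDerivAt
  have h2 : HasFDerivAt (fun x => residual A B b x p) B x :=
    ((B.hasFDerivAt.add_const (A p.fst)).sub_const b).sub_const p.snd
  have h3 := (innerSL ℝ u).hasFDerivAt.comp x h2
  have h4 := h2.norm_sq.const_mul (ρ / 2)
  rw [hasGradientAt_iff_hasFDerivAt]
  refine ((h1.add h3).add h4).congr_fderiv ?_
  ext d
  simp [slowField, -inner_gradient_left, ContinuousLinearMap.adjoint_inner_left]
  ring

lemma hasGradientAt_augmented_right (hq : Differentiable ℝ q) (x : Vec dx) (u : Vec dh)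
    (p : Pair dy dh) :
    HasGradientAt (fun p => augmented A B b ρ q x u p) (primalField A B b ρ q x u p) p := by
  have hfst : HasFDerivAt (fun p : Pair dy dh => p.fst) (WithLp.fstL 2 ℝ (Vec dy) (Vec dh)) p :=
    (WithLp.fstL 2 ℝ (Vec dy) (Vec dh)).hasFDerivAt
  have hsnd : HasFDerivAt (fun p : Pair dy dh => p.snd) (WithLp.sndL 2 ℝ (Vec dy) (Vec dh)) p :=
    (WithLp.sndL 2 ℝ (Vec dy) (Vec dh)).hasFDerivAt
  have h1 := (hasGradientAt_pair_right hq x p.fst).hasFDerivAt.comp p hfst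
  have h2 : HasFDerivAt (fun p : Pair dy dh => residual A B b x p)
      (A.comp (WithLp.fstL 2 ℝ (Vec dy) (Vec dh)) - WithLp.sndL 2 ℝ (Vec dy) (Vec dh)) p :=
    (((A.hasFDerivAt.comp p hfst).const_add (B x)).sub_const b).sub hsnd
  have h3 := (innerSL ℝ u).hasFDerivAt.comp p h2
  have h4 := h2.norm_sq.const_mul (ρ / 2)
  rw [hasGradientAt_iff_hasFDerivAt]
  refine ((h1.add h3).add h4).congr_fderiv ?_
  ext d
  rw [InnerProductSpace.toDual_apply_apply, inner_primalField]
  simp [-inner_gradient_left, inner_add_left, inner_smul_left, inner_sub_right]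
  ring

end Augmented

/-- A matrix as a continuous linear map between Euclidean spaces. -/
def matrixCLM {m n : ℕ} (M : Matrix (Fin m) (Fin n) ℝ) : Vec n →L[ℝ] Vec m :=
  LinearMap.toContinuousLinearMap (Matrix.toEuclideanLin M)

/-- Full row rank makes the transpose bounded below. -/
lemma exists_norm_le_adjoint {m n : ℕ} {M : Matrix (Fin m) (Fin n) ℝ} (hM : M.rank = m) :
    ∃ s : ℝ, 0 ≤ s ∧ ∀ u, ‖u‖ ≤ s * ‖ContinuousLinearMap.adjoint (matrixCLM M) u‖ := by
  have hsurj : Function.Surjective (matrixCLM M) := by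
    have h1 : LinearMap.range (Matrix.toEuclideanLin M) = ⊤ := by
      refine Submodule.eq_top_of_finrank_eq ?_
      rw [Matrix.toEuclideanLin_eq_toLin_orthonormal, ← M.rank_eq_finrank_range_toLin, hM,
        finrank_euclideanSpace_fin]
    exact LinearMap.range_eq_top.1 h1
  have hker : LinearMap.ker (ContinuousLinearMap.adjoint (matrixCLM M)).toLinearMap = ⊥ := by
    rw [LinearMap.ker_eq_bot']
    intro u hu
    obtain ⟨y, hy⟩ := hsurj u
    have h1 : inner ℝ (ContinuousLinearMap.adjoint (matrixCLM M) u) y = 0 := by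
      have : ContinuousLinearMap.adjoint (matrixCLM M) u = 0 := hu
      rw [this, inner_zero_left]
    rw [ContinuousLinearMap.adjoint_inner_left, hy] at h1
    exact inner_self_eq_zero.1 h1
  obtain ⟨K, _, hK⟩ := LinearMap.exists_antilipschitzWith _ hker
  refine ⟨K, K.2, fun u => ?_⟩
  have := hK.le_mul_dist u 0
  simpa using this

namespace Problem

variable {dx dy dh : ℕ} (P : Problem dx dy dh)

lemma h_eq (x : Vec dx) (y : Vec dy) :
    P.h x y = matrixCLM P.B x + matrixCLM P.A y - P.b := rfl

lemma K_eq (δ ρ₁ ρ₂ : ℝ) (x : Vec dx) (y' z' : Pair dy dh) (u v : Vec dh) :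
    P.K δ ρ₁ ρ₂ x y' z' u v
      = augmented (matrixCLM P.A) (matrixCLM P.B) P.b ρ₁ (P.gδ δ) x u y'
        - augmented (matrixCLM P.A) (matrixCLM P.B) P.b ρ₂ P.g x v z' := by
  simp only [K, augmented, φδ, gδ, residual, h_eq]
  ring

variable {P} {lf₀ lf₁ lg₁ : ℝ≥0} {μg : ℝ}

lemma differentiable_g (hP : P.Assumptions lf₀ lf₁ lg₁ μg) : Differentiable ℝ P.g := hP.g_contDiff.differentiable one_ne_zero

lemma differentiable_gδ (hP : P.Assumptions lf₀ lf₁ lg₁ μg) (δ : ℝ) : Differentiable ℝ (P.gδ δ) :=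
  fun p => (gradient_gδ hP δ p).differentiableAt

lemma step_x (hP : P.Assumptions lf₀ lf₁ lg₁ μg) (δ ρ₁ ρ₂ : ℝ) (s : StepSizes)
    (w : State dx dy dh) : (P.step δ ρ₁ ρ₂ s w).x = w.x - s.ηx •
    (slowField (matrixCLM P.A) (matrixCLM P.B) P.b ρ₁ (P.gδ δ) w.x (P.step δ ρ₁ ρ₂ s w).u w.y'
      - slowField (matrixCLM P.A) (matrixCLM P.B) P.b ρ₂ P.g w.x (P.step δ ρ₁ ρ₂ s w).v w.z') := by
  have h1 := (hasGradientAt_augmented_left (A := matrixCLM P.A) (B := matrixCLM P.B) (b := P.b)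
    (ρ := ρ₁) (differentiable_gδ hP δ) w.x (P.step δ ρ₁ ρ₂ s w).u w.y').hasFDerivAt
  have h2 := (hasGradientAt_augmented_left (A := matrixCLM P.A) (B := matrixCLM P.B) (b := P.b)
    (ρ := ρ₂) (differentiable_g hP) w.x (P.step δ ρ₁ ρ₂ s w).v w.z').hasFDerivAt
  have h3 : HasGradientAt (fun x => P.K δ ρ₁ ρ₂ x w.y' w.z' (P.step δ ρ₁ ρ₂ s w).u
      (P.step δ ρ₁ ρ₂ s w).v)
      (slowField (matrixCLM P.A) (matrixCLM P.B) P.b ρ₁ (P.gδ δ) w.x (P.step δ ρ₁ ρ₂ s w).u w.y'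
        - slowField (matrixCLM P.A) (matrixCLM P.B) P.b ρ₂ P.g w.x (P.step δ ρ₁ ρ₂ s w).v w.z')
      w.x := by
    simp only [K_eq]
    rw [hasGradientAt_iff_hasFDerivAt, map_sub]
    exact h1.sub h2
  rw [← h3.gradient]
  rfl

lemma step_y' (hP : P.Assumptions lf₀ lf₁ lg₁ μg) (δ ρ₁ ρ₂ : ℝ) (s : StepSizes)
    (w : State dx dy dh) : (P.step δ ρ₁ ρ₂ s w).y' = proj (Py dy dh) (w.y' - s.ηy •
    primalField (matrixCLM P.A) (matrixCLM P.B) P.b ρ₁ (P.gδ δ) w.x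
      (P.step δ ρ₁ ρ₂ s w).u w.y') := by
  have h1 := (hasGradientAt_augmented_right (A := matrixCLM P.A) (B := matrixCLM P.B) (b := P.b)
    (ρ := ρ₁) (differentiable_gδ hP δ) w.x (P.step δ ρ₁ ρ₂ s w).u w.y').hasFDerivAt
  have h3 : HasGradientAt (fun y' => P.K δ ρ₁ ρ₂ w.x y' w.z' (P.step δ ρ₁ ρ₂ s w).u
      (P.step δ ρ₁ ρ₂ s w).v)
      (primalField (matrixCLM P.A) (matrixCLM P.B) P.b ρ₁ (P.gδ δ) w.x
        (P.step δ ρ₁ ρ₂ s w).u w.y') w.y' := by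
    simp only [K_eq]
    rw [hasGradientAt_iff_hasFDerivAt]
    exact h1.sub_const _
  rw [← h3.gradient]
  rfl

lemma step_z' (hP : P.Assumptions lf₀ lf₁ lg₁ μg) (δ ρ₁ ρ₂ : ℝ) (s : StepSizes)
    (w : State dx dy dh) : (P.step δ ρ₁ ρ₂ s w).z' = proj (Py dy dh) (w.z' - s.ηz •
    primalField (matrixCLM P.A) (matrixCLM P.B) P.b ρ₂ P.g w.x
      (P.step δ ρ₁ ρ₂ s w).v w.z') := by
  have h1 := (hasGradientAt_augmented_right (A := matrixCLM P.A) (B := matrixCLM P.B) (b := P.b)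
    (ρ := ρ₂) (differentiable_g hP) w.x (P.step δ ρ₁ ρ₂ s w).v w.z').hasFDerivAt
  have h3 : HasGradientAt (fun z' => P.K δ ρ₁ ρ₂ w.x w.y' z' (P.step δ ρ₁ ρ₂ s w).u
      (P.step δ ρ₁ ρ₂ s w).v)
      (-primalField (matrixCLM P.A) (matrixCLM P.B) P.b ρ₂ P.g w.x
        (P.step δ ρ₁ ρ₂ s w).v w.z') w.z' := by
    simp only [K_eq]
    rw [hasGradientAt_iff_hasFDerivAt, map_neg]
    exact h1.const_sub _
  rw [sub_eq_add_neg, ← smul_neg, ← h3.gradient]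
  rfl

end Problem

/-! ### Identification of the solutions, multipliers and value functions -/

lemma argminOn_eq {α : Type} [Nonempty α] {S : Set α} {F : α → ℝ} {a : α} (ha : a ∈ S)
    (h : ∀ b ∈ S, b ≠ a → F a < F b) : argminOn S F = a := by
  have hex : ∃ a, a ∈ S ∧ IsMinOn F S a := ⟨a, ha, fun b hb => by
    change F a ≤ F b
    rcases eq_or_ne b a with rfl | hba
    · exact le_rfl
    · exact (h b hb hba).le⟩
  obtain ⟨h1, h2⟩ := Classical.epsilon_spec hex
  by_contra hne
  exact absurd (h2 ha) (not_le.2 (h _ h1 hne))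

section Multiplier

variable {dx dy dh : ℕ} {A : Vec dy →L[ℝ] Vec dh} {B : Vec dx →L[ℝ] Vec dh} {b : Vec dh}
  {m L s : ℝ} {q : Pair dx dy → ℝ} {x : Vec dx} {y : Vec dy} {u : Vec dh}

namespace IsKKT

lemma argminOn_eq (h : IsKKT A B b q x y u) (hq : LowerObjective m L q) (hm : 0 < m) :
    argminOn {y | ∀ i, (B x + A y - b) i ≤ 0} (fun y => q (pair x y)) = y := by
  refine SFLCB.argminOn_eq h.feasible fun y' hy' hne => ?_
  have h1 := h.growth hq hy'
  have h2 : 0 < ‖y' - y‖ := norm_pos_iff.2 (sub_ne_zero.2 hne)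
  have h3 : 0 < m / 2 * ‖y' - y‖ ^ 2 := by positivity
  linarith

lemma bddBelow_lagrangian (hq : LowerObjective m L q) (hm : 0 < m) (x : Vec dx) (v : Vec dh) :
    BddBelow (Set.range fun y => q (pair x y) + inner ℝ v (B x + A y - b)) := by
  set w := (gradient q (pair x 0)).snd + ContinuousLinearMap.adjoint A v with hw
  refine ⟨q (pair x 0) + inner ℝ v (B x - b) - ‖w‖ ^ 2 / (2 * m), ?_⟩
  rintro _ ⟨y, rfl⟩
  have h1 := hq.growth x 0 y
  have h2 : inner ℝ v (B x + A y - b)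
      = inner ℝ v (B x - b) + inner ℝ (ContinuousLinearMap.adjoint A v) y := by
    rw [ContinuousLinearMap.adjoint_inner_left, ← inner_add_right]
    congr 1
    abel
  have h3 : -(‖w‖ * ‖y‖) ≤ inner ℝ w y := neg_le_of_abs_le (abs_real_inner_le_norm _ _)
  have h4 : 0 ≤ m / 2 * (‖y‖ - ‖w‖ / m) ^ 2 := by positivity
  have h5 : m / 2 * (‖y‖ - ‖w‖ / m) ^ 2
      = m / 2 * ‖y‖ ^ 2 - ‖w‖ * ‖y‖ + ‖w‖ ^ 2 / (2 * m) := by field_simp; ring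
  rw [hw, inner_add_left, ← hw] at h3
  rw [sub_zero] at h1
  simp only
  linarith

/-- A KKT multiplier solves the dual problem, and full row rank of `A` makes the dual solution
unique: a second solution has the same Lagrangian minimizer `y`, hence the same image under `Aᵀ`. -/
lemma argmaxOn_eq (h : IsKKT A B b q x y u) (hq : LowerObjective m L q) (hm : 0 < m)
    (hs : ∀ u, ‖u‖ ≤ s * ‖ContinuousLinearMap.adjoint A u‖) :
    argmaxOn {u : Vec dh | ∀ i, 0 ≤ u i}
      (fun u => ⨅ y : Vec dy, (q (pair x y) + inner ℝ u (B x + A y - b))) = u := by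
  have hbdd := fun v => bddBelow_lagrangian (A := A) (B := B) (b := b) hq hm x v
  have hle : ∀ v : Vec dh, (∀ i, 0 ≤ v i) →
      (⨅ y : Vec dy, (q (pair x y) + inner ℝ v (B x + A y - b))) ≤ q (pair x y) := fun v hv => by
    refine (ciInf_le (hbdd v) y).trans ?_
    have := inner_nonpos_of_nonneg_of_nonpos hv h.feasible
    linarith
  have hge : q (pair x y)
      ≤ ⨅ y : Vec dy, (q (pair x y) + inner ℝ u (B x + A y - b)) := le_ciInf fun y' => by
    have h1 := hq.growth x y y'
    have h2 := h.inner_gradient_eq y'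
    have h3 : 0 ≤ m / 2 * ‖y' - y‖ ^ 2 := by positivity
    linarith
  have hex : ∃ a, a ∈ {u : Vec dh | ∀ i, 0 ≤ u i} ∧ IsMaxOn
      (fun u => ⨅ y : Vec dy, (q (pair x y) + inner ℝ u (B x + A y - b)))
      {u : Vec dh | ∀ i, 0 ≤ u i} a := ⟨u, h.nonneg, fun v hv => (hle v hv).trans hge⟩
  obtain ⟨h1, h2⟩ := Classical.epsilon_spec hex
  change argmaxOn {u : Vec dh | ∀ i, 0 ≤ u i} _ ∈ _ at h1
  change IsMaxOn _ _ (argmaxOn {u : Vec dh | ∀ i, 0 ≤ u i} _) at h2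
  set v := argmaxOn {u : Vec dh | ∀ i, 0 ≤ u i}
      (fun u => ⨅ y : Vec dy, (q (pair x y) + inner ℝ u (B x + A y - b))) with hv
  have h3 : q (pair x y) ≤ ⨅ y : Vec dy, (q (pair x y) + inner ℝ v (B x + A y - b)) :=
    hge.trans (h2 h.nonneg)
  have hmin : IsLocalMin (fun y => q (pair x y) + inner ℝ v (B x + A y - b)) y :=
    Filter.Eventually.of_forall fun y' => by
      have a1 := inner_nonpos_of_nonneg_of_nonpos h1 h.feasible
      have a2 := h3.trans (ciInf_le (hbdd v) y')
      simp only at a2 ⊢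
      linarith
  have hd1 := (hasGradientAt_pair_right hq.differentiable x y).hasFDerivAt
  have hd2 : HasFDerivAt (fun y => B x + A y - b) A y :=
    (A.hasFDerivAt.const_add (B x)).sub_const b
  have hd3 := hd1.add ((innerSL ℝ v).hasFDerivAt.comp y hd2)
  have hz := hmin.hasFDerivAt_eq_zero hd3
  have hst : (gradient q (pair x y)).snd + ContinuousLinearMap.adjoint A v = 0 := by
    refine ext_inner_right ℝ fun d => ?_
    have := congrArg (fun f => f d) hz
    rw [inner_add_left, ContinuousLinearMap.adjoint_inner_left, inner_zero_left]
    simpa [-inner_gradient_left] using this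
  have h4 := hs (v - u)
  rw [map_sub, ← add_sub_add_left_eq_sub _ _ (gradient q (pair x y)).snd, hst, h.stationary,
    sub_zero, norm_zero, mul_zero] at h4
  exact sub_eq_zero.1 (norm_le_zero_iff.1 h4)

end IsKKT

end Multiplier

namespace Problem

variable {dx dy dh : ℕ} {P : Problem dx dy dh} {lf₀ lf₁ lg₁ : ℝ≥0} {μg m m' L L' s δ : ℝ}
  {x : Vec dx} {y z : Vec dy} {u v : Vec dh}

lemma yStar_eq (h : IsKKT (matrixCLM P.A) (matrixCLM P.B) P.b P.g x z v)
    (hq : LowerObjective m L P.g) (hm : 0 < m) : P.yStar x = z := h.argminOn_eq hq hm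

lemma yStarδ_eq (h : IsKKT (matrixCLM P.A) (matrixCLM P.B) P.b (P.gδ δ) x y u)
    (hq : LowerObjective m L (P.gδ δ)) (hm : 0 < m) : P.yStarδ δ x = y := h.argminOn_eq hq hm

lemma vStar_eq (h : IsKKT (matrixCLM P.A) (matrixCLM P.B) P.b P.g x z v)
    (hq : LowerObjective m L P.g) (hm : 0 < m)
    (hs : ∀ u, ‖u‖ ≤ s * ‖ContinuousLinearMap.adjoint (matrixCLM P.A) u‖) : P.vStar x = v :=
  h.argmaxOn_eq hq hm hs

lemma uStarδ_eq (h : IsKKT (matrixCLM P.A) (matrixCLM P.B) P.b (P.gδ δ) x y u)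
    (hq : LowerObjective m L (P.gδ δ)) (hm : 0 < m)
    (hs : ∀ u, ‖u‖ ≤ s * ‖ContinuousLinearMap.adjoint (matrixCLM P.A) u‖) : P.uStarδ δ x = u :=
  h.argmaxOn_eq hq hm hs

/-- The min–max defining `Φ_δ` separates into two lower-level minimizations. -/
lemma mul_Φδ_eq (hδ : 0 < δ)
    (hy : IsKKT (matrixCLM P.A) (matrixCLM P.B) P.b (P.gδ δ) x y u)
    (hz : IsKKT (matrixCLM P.A) (matrixCLM P.B) P.b P.g x z v)
    (hqy : LowerObjective m L (P.gδ δ)) (hqz : LowerObjective m' L' P.g) (hm : 0 < m)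
    (hm' : 0 < m') :
    δ * P.Φδ δ x = P.gδ δ (pair x y) - P.g (pair x z) := by
  have hsup : ∀ y : P.Y x, (⨆ z : P.Y x,
      (P.f (pair x y) + (1 / δ) * (P.g (pair x y) - P.g (pair x z))))
      = P.f (pair x y) + (1 / δ) * (P.g (pair x y) - P.g (pair x z)) := fun y => by
    refine IsGreatest.csSup_eq ⟨⟨⟨z, hz.feasible⟩, rfl⟩, ?_⟩
    rintro _ ⟨⟨z', hz'⟩, rfl⟩
    have h1 := hz.growth hqz hz'
    have h2 : 0 ≤ m' / 2 * ‖z' - z‖ ^ 2 := by positivity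
    simp only
    gcongr
    linarith
  have hinf : P.Φδ δ x = P.f (pair x y) + (1 / δ) * (P.g (pair x y) - P.g (pair x z)) := by
    rw [Φδ]
    simp only [hsup]
    refine IsLeast.csInf_eq ⟨⟨⟨y, hy.feasible⟩, rfl⟩, ?_⟩
    rintro _ ⟨⟨y', hy'⟩, rfl⟩
    have h1 := hy.growth hqy hy'
    have h2 : 0 ≤ m / 2 * ‖y' - y‖ ^ 2 := by positivity
    simp only [gδ] at h1
    have h3 : 0 ≤ (1 / δ) * ((δ * P.f (pair x y') + P.g (pair x y'))
        - (δ * P.f (pair x y) + P.g (pair x y))) := by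
      have : 0 ≤ (δ * P.f (pair x y') + P.g (pair x y'))
        - (δ * P.f (pair x y) + P.g (pair x y)) := by linarith
      positivity
    have h4 : (1 / δ) * ((δ * P.f (pair x y') + P.g (pair x y'))
        - (δ * P.f (pair x y) + P.g (pair x y)))
        = (P.f (pair x y') + (1 / δ) * (P.g (pair x y') - P.g (pair x z)))
          - (P.f (pair x y) + (1 / δ) * (P.g (pair x y) - P.g (pair x z))) := by
      field_simp
      ring
    simp only
    linarith
  rw [hinf, gδ]
  field_simp
  ring

lemma Φδ_le_Φ (hδ : 0 < δ)
    (hy : IsKKT (matrixCLM P.A) (matrixCLM P.B) P.b (P.gδ δ) x y u)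
    (hz : IsKKT (matrixCLM P.A) (matrixCLM P.B) P.b P.g x z v)
    (hqy : LowerObjective m L (P.gδ δ)) (hqz : LowerObjective m' L' P.g) (hm : 0 < m)
    (hm' : 0 < m') : P.Φδ δ x ≤ P.Φ x := by
  have h1 := mul_Φδ_eq hδ hy hz hqy hqz hm hm'
  have h2 := hy.growth hqy hz.feasible
  have h3 : 0 ≤ m / 2 * ‖z - y‖ ^ 2 := by positivity
  rw [Φ, yStar_eq hz hqz hm']
  simp only [gδ] at h1 h2
  exact le_of_mul_le_mul_left (by linarith) hδ

/-- The lower-level gap of `y` is quadratic in `‖y - z‖`, so it absorbs the loss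
`l_{f,0} ‖y - z‖` in `f` up to a term of order `δ`. -/
lemma Φ_sub_le_Φδ (hP : P.Assumptions lf₀ lf₁ lg₁ μg) (hδ : 0 < δ)
    (hy : IsKKT (matrixCLM P.A) (matrixCLM P.B) P.b (P.gδ δ) x y u)
    (hz : IsKKT (matrixCLM P.A) (matrixCLM P.B) P.b P.g x z v)
    (hqy : LowerObjective m L (P.gδ δ)) (hqz : LowerObjective m' L' P.g) (hm : 0 < m)
    (hm' : 0 < m') : P.Φ x - δ * lf₀ ^ 2 / (2 * m') ≤ P.Φδ δ x := by
  have h1 := mul_Φδ_eq hδ hy hz hqy hqz hm hm'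
  have h2 := hz.growth hqz hy.feasible
  have h3 := hP.f_lipschitz.dist_le_mul (pair x y) hy.feasible (pair x z) hz.feasible
  rw [Real.dist_eq, dist_eq_norm, pair_sub_pair, sub_self] at h3
  have h4 : ‖(pair 0 (y - z) : Pair dx dy)‖ = ‖y - z‖ := WithLp.norm_toLp_snd 2 _ _ _
  rw [h4] at h3
  have h5 := (abs_le.1 h3).1
  rw [Φ, yStar_eq hz hqz hm']
  simp only [gδ] at h1
  have h6 : 0 ≤ m' / 2 * (‖y - z‖ - δ * lf₀ / m') ^ 2 := by positivity
  have h7 : m' / 2 * (‖y - z‖ - δ * lf₀ / m') ^ 2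
      = m' / 2 * ‖y - z‖ ^ 2 - δ * (lf₀ * ‖y - z‖) + δ * (δ * lf₀ ^ 2 / (2 * m')) := by
    field_simp; ring
  have h8 := mul_le_mul_of_nonneg_left h5 hδ.le
  exact le_of_mul_le_mul_left (by linarith) hδ

/-- On a ball, `Φ` is at most its value at the origin plus a Lipschitz term. -/
lemma Φ_le_of_norm_le (hP : P.Assumptions lf₀ lf₁ lg₁ μg) {C R : ℝ} (hC : 0 ≤ C)
    (hfeas : ∀ x, P.yStar x ∈ P.Y x)
    (hlip : ∀ x₁ x₂, ‖P.yStar x₁ - P.yStar x₂‖ ≤ C * ‖x₁ - x₂‖) (hx : ‖x‖ ≤ R) :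
    P.Φ x ≤ P.Φ 0 + lf₀ * ((1 + C) * R) := by
  have h1 := hP.f_lipschitz.dist_le_mul (pair x (P.yStar x)) (hfeas x)
    (pair 0 (P.yStar 0)) (hfeas 0)
  rw [Real.dist_eq, dist_eq_norm, pair_sub_pair] at h1
  have h2 := norm_pair_le (x - 0) (P.yStar x - P.yStar 0)
  have h3 := hlip x 0
  rw [sub_zero] at h2 h3
  have h4 : ‖pair (x - 0) (P.yStar x - P.yStar 0)‖ ≤ (1 + C) * R := by
    rw [sub_zero]
    calc _ ≤ (1 + C) * ‖x‖ := by linarith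
      _ ≤ _ := by gcongr
  have h5 : (lf₀ : ℝ) * ‖pair (x - 0) (P.yStar x - P.yStar 0)‖ ≤ lf₀ * ((1 + C) * R) := by gcongr
  have h6 := (abs_le.1 h1).2
  simp only [Φ]
  linarith

end Problem

/-! ### Descent of the algorithm and the iteration counts -/

/-- What the step sizes achieve for one value of `δ`: the scaled hyper-objective `δ Φ_δ` has gradient
field `G`, and an energy `e` of the state controls how many iterates can have `‖G‖ ≥ r`. -/
structure DescentCertificate {dx dy dh : ℕ} (P : Problem dx dy dh) (lf₀ : ℝ≥0)
    (μg δ ρ₁ ρ₂ C : ℝ) (s : StepSizes) (G : Vec dx → Vec dx) (e : State dx dy dh → ℝ) : Prop where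
  hasGradientAt : ∀ x, HasGradientAt (fun x => δ * P.Φδ δ x) (G x) x
  nonneg : ∀ w, 0 ≤ e w
  le_dist : ∀ w : State dx dy dh, e w ≤ C *
    ((‖w.y'.fst - P.yStarδ δ w.x‖ + ‖w.u - P.uStarδ δ w.x‖ + ‖w.y'.snd - P.h w.x w.y'.fst‖)
      + (‖w.z'.fst - P.yStar w.x‖ + ‖w.v - P.vStar w.x‖ + ‖w.z'.snd - P.h w.x w.z'.fst‖))
  le_norm : ∀ w : State dx dy dh, w.Admissible → e w ≤ C *
    ((‖gradient (P.gδ δ) 0‖ + ‖P.b‖ + ‖w.x‖ + ‖w.u‖ + ‖w.y'‖)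
      + (‖gradient P.g 0‖ + ‖P.b‖ + ‖w.x‖ + ‖w.v‖ + ‖w.z'‖))
  descent : ∀ (w : State dx dy dh) (low r : ℝ) (T : ℕ), (∀ x, low ≤ δ * P.Φδ δ x) → 0 ≤ r →
    (∀ t < T, r ≤ ‖G (P.iterate δ ρ₁ ρ₂ s w t).x‖) →
    T * (s.ηx / 2 * r ^ 2) ≤ δ * P.Φδ δ w.x - low + e w ^ 2
  Φδ_le_Φ : ∀ x, P.Φδ δ x ≤ P.Φ x
  Φ_sub_le_Φδ : ∀ x, P.Φ x - δ * lf₀ ^ 2 / μg ≤ P.Φδ δ x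

theorem exists_descentCertificate {dx dy dh : ℕ} (A : Matrix (Fin dh) (Fin dy) ℝ)
    (B : Matrix (Fin dh) (Fin dx) ℝ) (hA : A.rank = dh) (lf₁ lg₁ : ℝ≥0) (μg : ℝ) (hμg : 0 < μg)
    (ρ₁ ρ₂ : ℝ) (hρ₁ : 0 < ρ₁) (hρ₂ : 0 < ρ₂) :
    ∃ (s : StepSizes) (C : ℝ), s.Pos ∧ 0 < C ∧
      ∀ P : Problem dx dy dh, P.A = A → P.B = B → ∀ lf₀ : ℝ≥0, P.Assumptions lf₀ lf₁ lg₁ μg →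
        (∀ x, P.yStar x ∈ P.Y x) ∧
        (∀ x₁ x₂, ‖P.yStar x₁ - P.yStar x₂‖ ≤ C * ‖x₁ - x₂‖) ∧
        ∀ δ : ℝ, 0 < δ → 2 * lf₁ * δ ≤ μg →
          ∃ G e, DescentCertificate P lf₀ μg δ ρ₁ ρ₂ C s G e := by
  obtain ⟨σ, hσ0, hσ⟩ := exists_norm_le_adjoint hA
  have hm : 0 < μg / 2 := by positivity
  have hL : 0 ≤ (lg₁ : ℝ) + μg / 2 := by positivity
  obtain ⟨η₁, ηu, γ₁, C₁, hη₁, hηu, hγ₁, hγ₁1, hC₁, hblock₁⟩ :=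
    exists_blockEnergy (matrixCLM A) (matrixCLM B) hσ hσ0 hρ₁ hm hL
  obtain ⟨η₂, ηv, γ₂, C₂, hη₂, hηv, hγ₂, hγ₂1, hC₂, hblock₂⟩ :=
    exists_blockEnergy (matrixCLM A) (matrixCLM B) hσ hσ0 hρ₂ hm hL
  obtain ⟨C, hC⟩ : ∃ C, C = C₁ + C₂ := ⟨_, rfl⟩
  have hC0 : 0 < C := by rw [hC]; positivity
  have hC1 : C₁ ≤ C := by linarith
  have hC2 : C₂ ≤ C := by linarith
  obtain ⟨γ, hγ⟩ : ∃ γ, γ = min γ₁ γ₂ := ⟨_, rfl⟩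
  have hγ0 : 0 < γ := by rw [hγ]; exact lt_min hγ₁ hγ₂
  have hγ1 : γ ≤ γ₁ := by rw [hγ]; exact min_le_left _ _
  have hγ2 : γ ≤ γ₂ := by rw [hγ]; exact min_le_right _ _
  obtain ⟨η, hη⟩ : ∃ η, η = min (2 * γ / C ^ 2) (1 / 2 / (C + C ^ 2 / γ)) := ⟨_, rfl⟩
  have hη0 : 0 < η := by rw [hη]; exact lt_min (by positivity) (by positivity)
  have hη1 : η * C ^ 2 ≤ 2 * γ := by
    rw [← le_div_iff₀ (by positivity), hη]; exact min_le_left _ _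
  have hη2 : η * (C + C ^ 2 / γ) ≤ 1 / 2 := by
    rw [← le_div_iff₀ (by positivity), hη]; exact min_le_right _ _
  refine ⟨⟨η, η₁, η₂, ηu, ηv⟩, C, ⟨hη0, hη₁, hη₂, hηu, hηv⟩, hC0, ?_⟩
  rintro P rfl rfl lf₀ hP
  have hqz : LowerObjective (μg / 2) (lg₁ + μg / 2) P.g :=
    Problem.lowerObjective_g hP (by linarith) (by linarith)
  obtain ⟨zS, vS, E₂, hE₂⟩ := hblock₂ P.b P.g hqz
  have hz : ∀ x, P.yStar x = zS x := fun x => Problem.yStar_eq (hE₂.kkt x) hqz hm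
  have hv : ∀ x, P.vStar x = vS x := fun x => Problem.vStar_eq (hE₂.kkt x) hqz hm hσ
  refine ⟨fun x => ?_, fun x₁ x₂ => ?_, fun δ hδ hδμ => ?_⟩
  · rw [hz]; exact (hE₂.kkt x).feasible
  · rw [hz, hz]
    exact (hE₂.lip_yS x₁ x₂).trans (by gcongr)
  have hqy := Problem.lowerObjective_gδ hP hδ.le hδμ
  obtain ⟨yS, uS, E₁, hE₁⟩ := hblock₁ P.b (P.gδ δ) hqy
  have hy : ∀ x, P.yStarδ δ x = yS x := fun x => Problem.yStarδ_eq (hE₁.kkt x) hqy hm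
  have hu : ∀ x, P.uStarδ δ x = uS x := fun x => Problem.uStarδ_eq (hE₁.kkt x) hqy hm hσ
  have hF : ∀ x, δ * P.Φδ δ x = P.gδ δ (pair x (yS x)) - P.g (pair x (zS x)) := fun x =>
    Problem.mul_Φδ_eq hδ (hE₁.kkt x) (hE₂.kkt x) hqy hqz hm hm
  obtain ⟨G, hG⟩ : ∃ G : Vec dx → Vec dx, G = fun x =>
      ((gradient (P.gδ δ) (pair x (yS x))).fst
        + ContinuousLinearMap.adjoint (matrixCLM P.B) (uS x))
      - ((gradient P.g (pair x (zS x))).fst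
        + ContinuousLinearMap.adjoint (matrixCLM P.B) (vS x)) := ⟨_, rfl⟩
  have hexp : ∀ x₁ x₂, |δ * P.Φδ δ x₂ - δ * P.Φδ δ x₁ - inner ℝ (G x₁) (x₂ - x₁)|
      ≤ C * ‖x₂ - x₁‖ ^ 2 := fun x₁ x₂ => by
    have h1 := abs_le.1 (hE₁.expansion x₁ x₂)
    have h2 := abs_le.1 (hE₂.expansion x₁ x₂)
    rw [hF, hF, hG, hC, abs_le]
    simp only
    rw [inner_sub_left]
    constructor <;> linarith [h1.1, h1.2, h2.1, h2.2]
  refine ⟨G, fun w => E₁ w.x w.y' w.u + E₂ w.x w.z' w.v, ?_⟩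
  constructor
  · exact fun x => hasGradientAt_of_quadratic_error (hexp x)
  · exact fun w => add_nonneg (hE₁.nonneg _ _ _) (hE₂.nonneg _ _ _)
  · intro w
    have h1 := hE₁.le_dist w.x w.y' w.u
    have h2 := hE₂.le_dist w.x w.z' w.v
    rw [← Problem.h_eq] at h1 h2
    rw [hy, hu, hz, hv, mul_add]
    refine add_le_add (h1.trans ?_) (h2.trans ?_) <;> gcongr
  · intro w hw
    rw [mul_add]
    refine add_le_add ((hE₁.le_norm w.x w.y' w.u hw.1).trans ?_)
      ((hE₂.le_norm w.x w.z' w.v hw.2).trans ?_) <;> gcongr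
  · intro w low r T hlow hr hT
    set s : StepSizes := ⟨η, η₁, η₂, ηu, ηv⟩ with hs
    set W : ℕ → State dx dy dh := fun t => P.iterate δ ρ₁ ρ₂ s w t with hW
    have hWs : ∀ t, W (t + 1) = P.step δ ρ₁ ρ₂ s (W t) := fun t =>
      Function.iterate_succ_apply' _ _ _
    have hWu : ∀ t, (W (t + 1)).u
        = (W t).u + ηu • residual (matrixCLM P.A) (matrixCLM P.B) P.b (W t).x (W t).y' := fun t => by
      rw [hWs]; rfl
    have hWv : ∀ t, (W (t + 1)).v
        = (W t).v + ηv • residual (matrixCLM P.A) (matrixCLM P.B) P.b (W t).x (W t).z' := fun t => by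
      rw [hWs]; rfl
    refine card_mul_sq_le_of_inexact_descent (F := fun x => δ * P.Φδ δ x) (G := G) (C := C) (γ := γ)
      (x := fun t => (W t).x)
      (d := fun t => slowField (matrixCLM P.A) (matrixCLM P.B) P.b ρ₁ (P.gδ δ) (W t).x
          (W (t + 1)).u (W t).y'
        - slowField (matrixCLM P.A) (matrixCLM P.B) P.b ρ₂ P.g (W t).x (W (t + 1)).v (W t).z')
      (e := fun t => E₁ (W t).x (W t).y' (W t).u + E₂ (W t).x (W t).z' (W t).v)
      hγ0 (hγ1.trans hγ₁1) hη0 hη1 hη2 (fun a b => ?_) (fun t => ?_)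
      (fun t => add_nonneg (hE₁.nonneg _ _ _) (hE₂.nonneg _ _ _)) (fun t => ?_) (fun t => ?_)
      hlow hr T hT
    · linarith [(abs_le.1 (hexp a b)).2]
    · rw [hWs]; exact Problem.step_x hP δ ρ₁ ρ₂ s (W t)
    · have h1 := hE₁.slow_le (W t).x (W t).y' (W t).u
      have h2 := hE₂.slow_le (W t).x (W t).z' (W t).v
      rw [← hWu] at h1
      rw [← hWv] at h2
      rw [hG]
      simp only
      rw [sub_sub_sub_comm]
      refine (norm_sub_le _ _).trans ?_
      rw [mul_add]
      have h3 := hE₁.nonneg (W t).x (W t).y' (W t).u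
      have h4 := hE₂.nonneg (W t).x (W t).z' (W t).v
      refine add_le_add (h1.trans ?_) (h2.trans ?_) <;> gcongr
    · have h1 := hE₁.contract (W t).x (W t).y' (W t).u
      have h2 := hE₂.contract (W t).x (W t).z' (W t).v
      have hy' := Problem.step_y' hP δ ρ₁ ρ₂ s (W t)
      have hz' := Problem.step_z' hP δ ρ₁ ρ₂ s (W t)
      rw [← hWs] at hy' hz'
      rw [← hWu, ← hy'] at h1
      rw [← hWv, ← hz'] at h2
      have h3 := hE₁.drift (W (t + 1)).x (W t).x (W (t + 1)).y' (W (t + 1)).u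
      have h4 := hE₂.drift (W (t + 1)).x (W t).x (W (t + 1)).z' (W (t + 1)).v
      have h5 := mul_le_mul_of_nonneg_right hγ1 (hE₁.nonneg (W t).x (W t).y' (W t).u)
      have h6 := mul_le_mul_of_nonneg_right hγ2 (hE₂.nonneg (W t).x (W t).z' (W t).v)
      rw [hC]
      linarith
  · exact fun x => Problem.Φδ_le_Φ hδ (hE₁.kkt x) (hE₂.kkt x) hqy hqz hm hm
  · intro x
    have h1 := Problem.Φ_sub_le_Φδ hP hδ (hE₁.kkt x) (hE₂.kkt x) hqy hqz hm hm
    rwa [mul_div_cancel₀ μg two_ne_zero] at h1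

end SFLCB

end

theorem mainTheorem3 {dx dy dh : ℕ}
    (A : Matrix (Fin dh) (Fin dy) ℝ) (B : Matrix (Fin dh) (Fin dx) ℝ) (hA : A.rank = dh)
    (lf₀ lf₁ lg₁ : NNReal) (μg : ℝ) (hμg : 0 < μg)
    (ρ₁ ρ₂ : ℝ) (hρ₁ : 0 < ρ₁) (hρ₂ : 0 < ρ₂) :
    ∃ s : SFLCB.StepSizes, s.Pos ∧
      ∀ P : SFLCB.Problem dx dy dh, P.A = A → P.B = B → P.Assumptions lf₀ lf₁ lg₁ μg →
        ∀ c₁ c₂ : ℝ, 0 < c₁ → c₁ ≤ c₂ → ∀ R : ℝ, 0 < R →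
          (∃ C : ℝ, 0 < C ∧
            ∀ ε δ : ℝ, 0 < ε → ε ≤ 1 → c₁ * ε ≤ δ → δ ≤ c₂ * ε → 2 * lf₁ * δ ≤ μg →
              ∀ w₀ : SFLCB.State dx dy dh, w₀.Admissible → w₀.BoundedBy R →
                ∀ T : ℕ, C / ε ^ 4 ≤ T →
                  ∃ t < T, SFLCB.IsStationaryPoint ε (P.Φδ δ) (P.iterate δ ρ₁ ρ₂ s w₀ t).x) ∧
          (∀ κ : ℝ, 0 < κ → ∃ C : ℝ, 0 < C ∧
            ∀ ε δ : ℝ, 0 < ε → ε ≤ 1 → c₁ * ε ≤ δ → δ ≤ c₂ * ε → 2 * lf₁ * δ ≤ μg →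
              ∀ w₀ : SFLCB.State dx dy dh, w₀.Admissible → ‖w₀.x‖ ≤ R →
                P.CloseToOptimal δ κ w₀ →
                ∀ T : ℕ, C / ε ^ 3 ≤ T →
                  ∃ t < T, SFLCB.IsStationaryPoint ε (P.Φδ δ) (P.iterate δ ρ₁ ρ₂ s w₀ t).x) := by
  obtain ⟨s, C, hs, hC, hcert⟩ :=
    SFLCB.exists_descentCertificate A B hA lf₁ lg₁ μg hμg ρ₁ ρ₂ hρ₁ hρ₂
  refine ⟨s, hs, fun P hPA hPB hP c₁ c₂ hc₁ hc₁₂ R hR => ?_⟩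
  obtain ⟨hfeas, hlip, hcert⟩ := hcert P hPA hPB lf₀ hP
  obtain ⟨ℓ, hℓ⟩ := hP.Φ_bddBelow
  have hℓ : ∀ x, ℓ ≤ P.Φ x := fun x => hℓ ⟨x, rfl⟩
  have hc₂ : 0 < c₂ := hc₁.trans_le hc₁₂
  have hηx : 0 < s.ηx := hs.1
  -- `D` bounds the initial optimality gap of `Φ_δ`, uniformly in `δ ≤ c₂`.
  obtain ⟨D, hD⟩ : ∃ D, D = P.Φ 0 + lf₀ * ((1 + C) * R) - ℓ + c₂ * lf₀ ^ 2 / μg := ⟨_, rfl⟩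
  have hD0 : 0 ≤ D := by
    have h1 := hℓ 0
    have h2 : 0 ≤ lf₀ * ((1 + C) * R) + c₂ * lf₀ ^ 2 / μg := by positivity
    linarith
  have main : ∀ ε δ : ℝ, 0 < ε → ε ≤ 1 → c₁ * ε ≤ δ → δ ≤ c₂ * ε → 2 * lf₁ * δ ≤ μg →
      ∃ e : SFLCB.State dx dy dh → ℝ, (∀ w, 0 ≤ e w) ∧
        (∀ w : SFLCB.State dx dy dh, e w ≤ C *
          ((‖w.y'.fst - P.yStarδ δ w.x‖ + ‖w.u - P.uStarδ δ w.x‖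
              + ‖w.y'.snd - P.h w.x w.y'.fst‖)
            + (‖w.z'.fst - P.yStar w.x‖ + ‖w.v - P.vStar w.x‖
              + ‖w.z'.snd - P.h w.x w.z'.fst‖))) ∧
        (∀ w : SFLCB.State dx dy dh, w.Admissible → w.BoundedBy R → e w ≤ C *
          (c₂ * ‖gradient P.f 0‖ + 2 * ‖gradient P.g 0‖ + 2 * ‖P.b‖ + 6 * R)) ∧
        ∀ (w : SFLCB.State dx dy dh) (T : ℕ), ‖w.x‖ ≤ R →
          δ * D + e w ^ 2 < T * (s.ηx / 2 * (δ * ε) ^ 2) →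
          ∃ t < T, SFLCB.IsStationaryPoint ε (P.Φδ δ) (P.iterate δ ρ₁ ρ₂ s w t).x := by
    intro ε δ hε hε1 hδ1 hδ2 hδμ
    have hδ : 0 < δ := lt_of_lt_of_le (by positivity) hδ1
    have hδc : δ ≤ c₂ := hδ2.trans (by nlinarith)
    obtain ⟨G, e, hGe⟩ := hcert δ hδ hδμ
    refine ⟨e, hGe.nonneg, hGe.le_dist, fun w hw hb => ?_, fun w T hx hT => ?_⟩
    · refine (hGe.le_norm w hw).trans ?_
      obtain ⟨h1, h2, h3, h4, h5⟩ := hb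
      have h6 : ‖gradient (P.gδ δ) 0‖ ≤ c₂ * ‖gradient P.f 0‖ + ‖gradient P.g 0‖ := by
        rw [(SFLCB.Problem.gradient_gδ hP δ 0).gradient]
        refine (norm_add_le _ _).trans ?_
        rw [norm_smul, Real.norm_of_nonneg hδ.le]
        gcongr
      refine mul_le_mul_of_nonneg_left ?_ hC.le
      linarith
    · have hgrad : ∀ x, HasGradientAt (P.Φδ δ) (δ⁻¹ • G x) x := fun x => by
        have h1 := (hGe.hasGradientAt x).hasFDerivAt.const_mul δ⁻¹
        rw [hasGradientAt_iff_hasFDerivAt, map_smul]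
        refine h1.congr_of_eventuallyEq (Filter.Eventually.of_forall fun x => ?_)
        simp only
        rw [inv_mul_cancel_left₀ hδ.ne']
      have hdiff : Differentiable ℝ (P.Φδ δ) := fun x => (hgrad x).differentiableAt
      by_contra! hcon
      have hlarge : ∀ t < T, δ * ε ≤ ‖G (P.iterate δ ρ₁ ρ₂ s w t).x‖ := fun t ht => by
        have h1 : ¬ ‖gradient (P.Φδ δ) (P.iterate δ ρ₁ ρ₂ s w t).x‖ ≤ ε :=
          fun h => hcon t ht ⟨hdiff, h⟩
        rw [(hgrad _).gradient, norm_smul, norm_inv, Real.norm_of_nonneg hδ.le, not_le,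
          ← div_eq_inv_mul, lt_div_iff₀ hδ] at h1
        linarith
      have hlow : ∀ x, δ * (ℓ - c₂ * lf₀ ^ 2 / μg) ≤ δ * P.Φδ δ x := fun x => by
        have h1 := hGe.Φ_sub_le_Φδ x
        have h2 : δ * lf₀ ^ 2 / μg ≤ c₂ * lf₀ ^ 2 / μg := by gcongr
        have h3 := hℓ x
        gcongr
        linarith
      have h1 := hGe.descent w _ (δ * ε) T hlow (by positivity) hlarge
      have h2 : δ * P.Φδ δ w.x ≤ δ * (P.Φ 0 + lf₀ * ((1 + C) * R)) := by
        gcongr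
        exact (hGe.Φδ_le_Φ w.x).trans (SFLCB.Problem.Φ_le_of_norm_le hP hC.le hfeas hlip hx)
      rw [hD] at hT
      linarith
  constructor
  · obtain ⟨e₀, he₀⟩ : ∃ e₀, e₀ = C *
      (c₂ * ‖gradient P.f 0‖ + 2 * ‖gradient P.g 0‖ + 2 * ‖P.b‖ + 6 * R) := ⟨_, rfl⟩
    obtain ⟨W, hW⟩ : ∃ W, W = c₂ * D + e₀ ^ 2 + 1 := ⟨_, rfl⟩
    have hW0 : 0 < W := by rw [hW]; positivity
    refine ⟨2 * W / (s.ηx * c₁ ^ 2), by positivity, fun ε δ hε hε1 hδ1 hδ2 hδμ w hw hb T hT => ?_⟩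
    obtain ⟨e, h0, -, hnorm, hstat⟩ := main ε δ hε hε1 hδ1 hδ2 hδμ
    refine hstat w T hb.1 ?_
    have h1 : e w ^ 2 ≤ e₀ ^ 2 := pow_le_pow_left₀ (h0 w) (he₀ ▸ hnorm w hw hb) 2
    have h2 : δ * D ≤ c₂ * D := by
      gcongr
      exact hδ2.trans (by nlinarith)
    calc δ * D + e w ^ 2 < W := by linarith
      _ = 2 * W / (s.ηx * c₁ ^ 2) / ε ^ 4 * (s.ηx / 2 * (c₁ * ε * ε) ^ 2) := by field_simp
      _ ≤ T * (s.ηx / 2 * (δ * ε) ^ 2) := by gcongr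
  · intro κ hκ
    obtain ⟨W, hW⟩ : ∃ W, W = D + (6 * C * κ) ^ 2 * c₂ + 1 := ⟨_, rfl⟩
    have hW0 : 0 < W := by rw [hW]; positivity
    refine ⟨2 * W / (s.ηx * c₁), by positivity, fun ε δ hε hε1 hδ1 hδ2 hδμ w hw hx hcl T hT => ?_⟩
    obtain ⟨e, h0, hdist, -, hstat⟩ := main ε δ hε hε1 hδ1 hδ2 hδμ
    have hδ : 0 < δ := lt_of_lt_of_le (by positivity) hδ1
    have hδc : δ ≤ c₂ := hδ2.trans (by nlinarith)
    refine hstat w T hx ?_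
    obtain ⟨k1, k2, k3, k4, k5, k6⟩ := hcl
    have h1 : e w ≤ 6 * C * κ * δ := by
      refine (hdist w).trans ?_
      calc _ ≤ C * ((κ * δ + κ * δ + κ * δ) + (κ * δ + κ * δ + κ * δ)) := by gcongr
        _ = _ := by ring
    have h2 : e w ^ 2 ≤ δ * ((6 * C * κ) ^ 2 * c₂) := by
      calc e w ^ 2 ≤ (6 * C * κ * δ) ^ 2 := pow_le_pow_left₀ (h0 w) h1 2
        _ = δ * ((6 * C * κ) ^ 2 * δ) := by ring
        _ ≤ _ := by gcongr
    calc δ * D + e w ^ 2 < δ * W := by rw [hW]; linarith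
      _ = δ * (2 * W / (s.ηx * c₁) / ε ^ 3 * (s.ηx / 2 * (c₁ * ε) * ε ^ 2)) := by field_simp
      _ ≤ δ * (T * (s.ηx / 2 * δ * ε ^ 2)) := by gcongr
      _ = T * (s.ηx / 2 * (δ * ε) ^ 2) := by ring
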